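/- Let $P\in\mathbb Z[x]$ be monic of degree $n\ge 2$ and irreducible over $\mathbb Q$, let $\alpha$ be a root of $P$ and $K=\mathbb Q(\alpha)$. Let $\sigma_1,\dots,\sigma_{r_1}$ be the real embeddings of $K$ and $\sigma_{r_1+1},\dots,\sigma_{r_1+2r_2}$ the non-real ones, numbered so that $\sigma_{r_1+r_2+i}=\overline{\sigma_{r_1+i}}$ for $1\le i\le r_2$; so $n=r_1+2r_2$. Let $G=\{g\in \mathrm{GL}_n(\mathbb R):\det g=\pm1\}$ and $\Gamma=\mathrm{GL}_n(\mathbb Z)$. Let $X_0\in \mathrm M_n(\mathbb Z)$ have characteristic polynomial $P$, and let $H=\{g\in G: gX_0g^{-1}=X_0\}$. Let $X_1=\mathrm{diag}(d_1,\dots,d_{r_1+r_2})$, where $d_i=\sigma_i(\alpha)$ for $i\le r_1$ and $d_i=\begin{pmatrix}a&-b\\ b&a\end{pmatrix}$, with $\sigma_i(\alpha)=a+b\sqrt{-1}$, for $i>r_1$. Let $g_0\in G$ with $g_0X_0g_0^{-1}=X_1$, put $\psi(g)=g_0gg_0^{-1}$, $H_1=\psi(H)=\{g\in G:gX_1g^{-1}=X_1\}$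 and $\Gamma_1=\psi(\Gamma)$. Then $H_1$ is the direct product $\Sigma\cdot K_1\cdot C$, where $\Sigma$ is the group of matrices $\mathrm{diag}(\epsilon_1,\dots,\epsilon_{r_1},I_2,\dots,I_2)$ with $\epsilon_i=\pm1$, $K_1$ is the group of matrices $\mathrm{diag}(1,\dots,1,k_1,\dots,k_{r_2})$ with $k_i\in\mathrm{SO}(2)$, and $C$ is the group of matrices $\mathrm{diag}(c_1,\dots,c_{r_1},c_{r_1+1}^{1/2}I_2,\dots,c_{r_1+r_2}^{1/2}I_2)$ with $c_i>0$ and $\prod_i c_i=1$. Let $\theta$ be the Haar probability measure on $K_1$ and $dc=\prod_{i=1}^{r_1+r_2-1}dc_i/c_i$ on $C$. Let $\tilde\nu_1$ be the Haar measure on $H_1$ with $$\int_{H_1}f\,d\tilde\nu_1=\sum_{s\in\Sigma}\int_{K_1\times C}f(skc)\,d\theta(k)\,dc,$$ and $\tilde\nu$ the Haar measure on $H$ with $\psi_*\tilde\nu=\tilde\nu_1$. Let $\nu$ and $\nu_1$ be the measures on $H/(H\cap\Gamma)$ and $H_1/(H_1\cap\Gamma_1)$ corresponding to $\tilde\nu$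 and $\tilde\nu_1$ (and to the counting measures on the subgroups), that is, the unique measures with $\int_H f\,d\tilde\nu=\int_{H/(H\cap\Gamma)}\sum_{\gamma\in H\cap\Gamma}f(h\gamma)\,d\nu$ for all Borel $f\ge 0$, and likewise for $\nu_1$. Let $\omega=(\omega_1,\dots,\omega_n)^{t}\in\mathbb Z[\alpha]^n$ be nonzero with $X_0\omega=\alpha\omega$, let $I_{X_0}=\mathbb Z\omega_1+\dots+\mathbb Z\omega_n$ be the associated ideal of $\mathbb Z[\alpha]$, and let $\mathfrak O=\{\beta\in K:\beta I_{X_0}\subset I_{X_0}\}$ be its order. Let $w_{\mathfrak O}$ be the number of roots of unity in $\mathfrak O$. Let $R_{\mathfrak O}=\bigl|\det(\nu_i\log|\sigma_i(\epsilon_j)|)_{i,j=1}^{r_1+r_2-1}\bigr|$ be the regulator of $\mathfrak O$, where $\nu_i=1$ for $i\le r_1$, $\nu_i=2$ for $i>r_1$, and $\epsilon_1,\dots,\epsilon_{r_1+r_2-1}$ is any system of fundamental units of $\mathfrak O$, i.e. a basis of $\mathfrak O^\times$ modulo roots of unity (such systems exist, and $R_{\mathfrak O}$ does not depend on the choice).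 Then $$\nu\bigl(H/(H\cap\Gamma)\bigr)=\nu_1\bigl(H_1/(H_1\cap\Gamma_1)\bigr)=\frac{2^{r_1}R_{\mathfrak O}}{w_{\mathfrak O}}.$$ -/

import Mathlib

open MeasureTheory

noncomputable section

namespace CentralizerTorus

/-! ### Real matrix groups -/

/-- `GL_n(ℝ)` carries its Borel `σ`-algebra; subgroups and their coset spaces inherit theirs. -/
instance instMeasurableSpaceGL (n : ℕ) : MeasurableSpace (GL (Fin n) ℝ) :=
  borel _

instance instBorelSpaceGL (n : ℕ) : BorelSpace (GL (Fin n) ℝ) :=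
  ⟨rfl⟩

/-- The group `G = {g ∈ GL_n(ℝ) : det g = ± 1}`. -/
def detPmOne (n : ℕ) : Subgroup (GL (Fin n) ℝ) where
  carrier := {g | (g : Matrix (Fin n) (Fin n) ℝ).det = 1 ∨
    (g : Matrix (Fin n) (Fin n) ℝ).det = -1}
  one_mem' := by simp
  mul_mem' := by
    rintro a b (ha | ha) (hb | hb) <;> simp [ha, hb]
  inv_mem' := by
    intro a ha
    have h : (a : Matrix (Fin n) (Fin n) ℝ).det *
        ((a⁻¹ : GL (Fin n) ℝ) : Matrix (Fin n) (Fin n) ℝ).det = 1 := by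
      rw [← Matrix.det_mul, ← Units.val_mul, mul_inv_cancel, Units.val_one, Matrix.det_one]
    rcases ha with ha | ha <;> rw [ha] at h
    · left
      linarith
    · right
      linarith

/-- The centralizer `{g ∈ G : g X g⁻¹ = X}` of a real matrix `X` in `G`. -/
def torus {n : ℕ} (X : Matrix (Fin n) (Fin n) ℝ) : Subgroup (GL (Fin n) ℝ) where
  carrier := {g | g ∈ detPmOne n ∧
    (g : Matrix (Fin n) (Fin n) ℝ) * X * ((g⁻¹ : GL (Fin n) ℝ) : Matrix (Fin n) (Fin n) ℝ) = X}
  one_mem' := ⟨one_mem _, by simp⟩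
  mul_mem' := by
    rintro a b ⟨ha, ha'⟩ ⟨hb, hb'⟩
    refine ⟨mul_mem ha hb, ?_⟩
    rw [mul_inv_rev, Units.val_mul, Units.val_mul]
    calc _ = (a : Matrix (Fin n) (Fin n) ℝ) * ((b : Matrix (Fin n) (Fin n) ℝ) * X *
          ((b⁻¹ : GL (Fin n) ℝ) : Matrix (Fin n) (Fin n) ℝ)) *
          ((a⁻¹ : GL (Fin n) ℝ) : Matrix (Fin n) (Fin n) ℝ) := by simp only [mul_assoc]
      _ = X := by rw [hb', ha']
  inv_mem' := by
    rintro a ⟨ha, ha'⟩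
    refine ⟨inv_mem ha, ?_⟩
    rw [inv_inv]
    calc _ = ((a⁻¹ : GL (Fin n) ℝ) : Matrix (Fin n) (Fin n) ℝ) *
          ((a : Matrix (Fin n) (Fin n) ℝ) * X *
          ((a⁻¹ : GL (Fin n) ℝ) : Matrix (Fin n) (Fin n) ℝ)) * (a : Matrix (Fin n) (Fin n) ℝ) := by
          rw [ha']
      _ = X := by
          simp only [mul_assoc, Units.inv_mul, mul_one]
          rw [← mul_assoc, Units.inv_mul, one_mul]

/-- `Γ = GL_n(ℤ)` as a subgroup of `GL_n(ℝ)`. -/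
def glInt (n : ℕ) : Subgroup (GL (Fin n) ℝ) :=
  (Matrix.GeneralLinearGroup.map (n := Fin n) (Int.castRingHom ℝ)).range

/-- If `g₀ X g₀⁻¹ = Y`, the isomorphism `ψ : h ↦ g₀ h g₀⁻¹` from the centralizer of `X` onto
the centralizer of `Y`. -/
def conjTorus {n : ℕ} {X Y : Matrix (Fin n) (Fin n) ℝ} (g₀ : GL (Fin n) ℝ)
    (hg : (g₀ : Matrix (Fin n) (Fin n) ℝ) * X *
      ((g₀⁻¹ : GL (Fin n) ℝ) : Matrix (Fin n) (Fin n) ℝ) = Y) :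
    torus X ≃* torus Y where
  toFun h := ⟨g₀ * h * g₀⁻¹, by
    obtain ⟨h, hd, hX⟩ := h
    refine ⟨?_, ?_⟩
    · have e : ((g₀ * h * g₀⁻¹ : GL (Fin n) ℝ) : Matrix (Fin n) (Fin n) ℝ).det =
          (h : Matrix (Fin n) (Fin n) ℝ).det := by
        rw [Units.val_mul, Units.val_mul, Matrix.det_mul, Matrix.det_mul, mul_right_comm,
          ← Matrix.det_mul, ← Units.val_mul, mul_inv_cancel, Units.val_one, Matrix.det_one,
          one_mul]
      change _ ∨ _
      rw [e]
      exact hd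
    · subst hg
      simp only [mul_inv_rev, inv_inv, Units.val_mul, mul_assoc, Units.inv_mul_cancel_left]
      simp only [mul_assoc] at hX
      rw [← mul_assoc X, ← mul_assoc (h : Matrix (Fin n) (Fin n) ℝ),
        ← mul_assoc (h : Matrix (Fin n) (Fin n) ℝ), mul_assoc (h : Matrix (Fin n) (Fin n) ℝ),
        hX]⟩
  invFun h := ⟨g₀⁻¹ * h * g₀, by
    obtain ⟨h, hd, hY⟩ := h
    refine ⟨?_, ?_⟩
    · have e : ((g₀⁻¹ * h * g₀ : GL (Fin n) ℝ) : Matrix (Fin n) (Fin n) ℝ).det =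
          (h : Matrix (Fin n) (Fin n) ℝ).det := by
        rw [Units.val_mul, Units.val_mul, Matrix.det_mul, Matrix.det_mul, mul_right_comm,
          ← Matrix.det_mul, ← Units.val_mul, inv_mul_cancel, Units.val_one, Matrix.det_one,
          one_mul]
      change _ ∨ _
      rw [e]
      exact hd
    · have hX : X = ((g₀⁻¹ : GL (Fin n) ℝ) : Matrix (Fin n) (Fin n) ℝ) * Y *
          (g₀ : Matrix (Fin n) (Fin n) ℝ) := by
        rw [← hg]
        simp [mul_assoc]
      subst hX
      simp only [mul_inv_rev, inv_inv, Units.val_mul, mul_assoc, Units.mul_inv_cancel_left]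
      simp only [mul_assoc] at hY
      rw [← mul_assoc Y, ← mul_assoc (h : Matrix (Fin n) (Fin n) ℝ),
        ← mul_assoc (h : Matrix (Fin n) (Fin n) ℝ), mul_assoc (h : Matrix (Fin n) (Fin n) ℝ),
        hY]⟩
  left_inv h := by
    ext1
    simp [mul_assoc]
  right_inv h := by
    ext1
    simp [mul_assoc]
  map_mul' a b := by
    ext1
    simp [mul_assoc]

/-! ### Numberings of the embeddings and the block diagonal model -/

/-- A numbering `σ_1, …, σ_{r₁+2r₂}` of all the field embeddings of `K`: first the real ones
(`real`), then one from each pair of complex conjugate ones (`cplx`), then the conjugates of the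
latter. -/
structure EmbeddingNumbering (K : Type*) [Field K] (r₁ r₂ : ℕ) where
  real : Fin r₁ → (K →+* ℝ)
  cplx : Fin r₂ → (K →+* ℂ)
  bijective : Function.Bijective
    (Sum.elim (fun i => Complex.ofRealHom.comp (real i))
      (Sum.elim cplx (fun j => (starRingEnd ℂ).comp (cplx j))) :
      Fin r₁ ⊕ (Fin r₂ ⊕ Fin r₂) → (K →+* ℂ))

/-- The order in which the blocks are laid out: `r₁` rows of `1 × 1` blocks, then `r₂` consecutive
pairs of rows. The pair `(s, j)` is row `s` of the `j`-th `2 × 2` block. -/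
def blockIndex {n r₁ r₂ : ℕ} (hn : r₁ + r₂ * 2 = n) : Fin r₁ ⊕ (Fin 2 × Fin r₂) ≃ Fin n :=
  ((Equiv.refl _).sumCongr ((Equiv.prodComm _ _).trans finProdFinEquiv)).trans
    (finSumFinEquiv.trans (finCongr hn))

/-- `diag(a_1, …, a_{r₁}, d_1, …, d_{r₂})` with `2 × 2` blocks `d_j = (x_j, -y_j; y_j, x_j)` for
`z_j = x_j + i y_j`. -/
def blockMatrix {n r₁ r₂ : ℕ} (hn : r₁ + r₂ * 2 = n) (a : Fin r₁ → ℝ) (z : Fin r₂ → ℂ) :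
    Matrix (Fin n) (Fin n) ℝ :=
  Matrix.reindex (blockIndex hn) (blockIndex hn)
    (Matrix.fromBlocks (Matrix.diagonal a) 0 0
      (Matrix.blockDiagonal fun j => !![(z j).re, -(z j).im; (z j).im, (z j).re]))

theorem blockMatrix_mul {n r₁ r₂ : ℕ} (hn : r₁ + r₂ * 2 = n) (a a' : Fin r₁ → ℝ)
    (z z' : Fin r₂ → ℂ) :
    blockMatrix hn a z * blockMatrix hn a' z' = blockMatrix hn (a * a') (z * z') := by
  simp only [blockMatrix, Matrix.reindex_apply, Matrix.submatrix_mul_equiv]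
  rw [Matrix.fromBlocks_multiply]
  simp only [Matrix.zero_mul, Matrix.mul_zero, add_zero, zero_add, Matrix.diagonal_mul_diagonal,
    ← Matrix.blockDiagonal_mul]
  congr 3
  funext j
  ext s t
  fin_cases s <;> fin_cases t <;> simp [Matrix.mul_apply, Fin.sum_univ_two] <;> ring

theorem det_blockMatrix {n r₁ r₂ : ℕ} (hn : r₁ + r₂ * 2 = n) (a : Fin r₁ → ℝ)
    (z : Fin r₂ → ℂ) :
    (blockMatrix hn a z).det = (∏ i, a i) * ∏ j, ‖z j‖ ^ 2 := by
  rw [blockMatrix, Matrix.det_reindex_self, Matrix.det_fromBlocks_zero₂₁, Matrix.det_diagonal,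
    Matrix.det_blockDiagonal]
  congr 1
  refine Finset.prod_congr rfl fun j _ => ?_
  rw [Matrix.det_fin_two_of, ← Complex.normSq_eq_norm_sq, Complex.normSq_apply]
  ring

/-- The block diagonal element of the centralizer of a block diagonal matrix with prescribed
blocks. -/
def torusPoint {n r₁ r₂ : ℕ} (hn : r₁ + r₂ * 2 = n) (b : Fin r₁ → ℝ) (w : Fin r₂ → ℂ)
    (a : Fin r₁ → ℝ) (z : Fin r₂ → ℂ) (h : |∏ i, a i| * ∏ j, ‖z j‖ ^ 2 = 1) :
    torus (blockMatrix hn b w) :=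
  have hd : (blockMatrix hn a z).det = 1 ∨ (blockMatrix hn a z).det = -1 := by
    rw [← abs_eq zero_le_one, det_blockMatrix, abs_mul,
      abs_of_nonneg (Finset.prod_nonneg fun j _ => sq_nonneg ‖z j‖), h]
  ⟨Matrix.GeneralLinearGroup.mkOfDetNeZero (blockMatrix hn a z)
      (by rcases hd with hd | hd <;> rw [hd] <;> norm_num), hd, by
    rw [Units.mul_inv_eq_iff_eq_mul]
    change blockMatrix hn a z * _ = _ * blockMatrix hn a z
    rw [blockMatrix_mul, blockMatrix_mul, mul_comm a, mul_comm z]⟩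

/-! ### The chosen Haar measures -/

/-- The element `diag(ε_1, …, ε_{r₁}, I_2, …, I_2)` of `Σ`. -/
def signPoint {n r₁ r₂ : ℕ} (hn : r₁ + r₂ * 2 = n) (b : Fin r₁ → ℝ) (w : Fin r₂ → ℂ)
    (ε : Fin r₁ → ℤˣ) : torus (blockMatrix hn b w) :=
  torusPoint hn b w (fun i => ((ε i : ℤ) : ℝ)) 1 (by
    rw [Finset.abs_prod]
    have : ∀ i, |((ε i : ℤ) : ℝ)| = 1 := fun i => by
      rcases Int.units_eq_one_or (ε i) with h | h <;> simp [h]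
    simp [this])

/-- The element `diag(1, …, 1, k_1, …, k_{r₂})` of `K₁`, where `k_j ∈ SO(2)` is the rotation by the
angle `2π θ_j`. The group `SO(2)` is parametrized by `ℝ/ℤ`. -/
def rotationPoint {n r₁ r₂ : ℕ} (hn : r₁ + r₂ * 2 = n) (b : Fin r₁ → ℝ) (w : Fin r₂ → ℂ)
    (θ : Fin r₂ → UnitAddCircle) : torus (blockMatrix hn b w) :=
  torusPoint hn b w 1 (fun j => (AddCircle.toCircle (θ j) : ℂ)) (by
    have : ∀ j, ‖(AddCircle.toCircle (θ j) : ℂ)‖ = 1 := fun j => Circle.norm_coe _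
    simp [this])

/-- From the coordinates `c_1, …, c_{m-1} > 0` to `(c_1, …, c_m)` with `c_1 ⋯ c_m = 1`. -/
def fullCoord {m : ℕ} (c : Fin (m - 1) → Set.Ioi (0 : ℝ)) (i : Fin m) : ℝ :=
  if h : (i : ℕ) < m - 1 then (c ⟨i, h⟩ : ℝ) else (∏ j, (c j : ℝ))⁻¹

theorem fullCoord_pos {m : ℕ} (c : Fin (m - 1) → Set.Ioi (0 : ℝ)) (i : Fin m) :
    0 < fullCoord c i := by
  unfold fullCoord
  split_ifs with h
  · exact (c ⟨i, h⟩).2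
  · exact inv_pos.2 (Finset.prod_pos fun j _ => (c j).2)

theorem prod_fullCoord {m : ℕ} (c : Fin (m - 1) → Set.Ioi (0 : ℝ)) :
    ∏ i, fullCoord c i = 1 := by
  rcases m with _ | m
  · simp
  · rw [Fin.prod_univ_castSucc]
    have h1 : ∀ i : Fin m, fullCoord c i.castSucc = (c i : ℝ) := fun i => by
      unfold fullCoord
      rw [dif_pos (by simp)]
      rfl
    have h2 : fullCoord c (Fin.last m) = (∏ j : Fin m, (c j : ℝ))⁻¹ := by
      unfold fullCoord
      rw [dif_neg (by simp)]
      rfl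
    rw [h2, Finset.prod_congr rfl fun i _ => h1 i]
    exact mul_inv_cancel₀ (Finset.prod_pos fun j _ => (c j).2).ne'

/-- The element `diag(c_1, …, c_{r₁}, c_{r₁+1}^{1/2} I_2, …, c_{r₁+r₂}^{1/2} I_2)` of `C`, as a
function of the free coordinates `c_1, …, c_{r₁+r₂-1}`. -/
def scalingPoint {n r₁ r₂ : ℕ} (hn : r₁ + r₂ * 2 = n) (b : Fin r₁ → ℝ) (w : Fin r₂ → ℂ)
    (c : Fin (r₁ + r₂ - 1) → Set.Ioi (0 : ℝ)) : torus (blockMatrix hn b w) :=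
  torusPoint hn b w (fun i => fullCoord c (Fin.castAdd r₂ i))
    (fun j => (Real.sqrt (fullCoord c (Fin.natAdd r₁ j)) : ℂ)) (by
      have h := prod_fullCoord c
      rw [Fin.prod_univ_add] at h
      rw [abs_of_pos (Finset.prod_pos fun i _ => fullCoord_pos c _), ← h]
      congr 1
      refine Finset.prod_congr rfl fun j _ => ?_
      rw [Complex.norm_real, Real.norm_eq_abs, sq_abs, Real.sq_sqrt (fullCoord_pos c _).le])

/-- The Haar probability measure `θ` on `K₁ ≅ SO(2)^{r₂}`. -/
def rotationMeasure (r₂ : ℕ) : Measure (Fin r₂ → UnitAddCircle) :=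
  Measure.pi fun _ => AddCircle.haarAddCircle

/-- The measure `dc = (dc_1/c_1) ⋯ (dc_m/c_m)` on the positive coordinates `(c_1, …, c_m)`. -/
def scalingMeasure (m : ℕ) : Measure (Fin m → Set.Ioi (0 : ℝ)) :=
  Measure.pi fun _ => Measure.comap Subtype.val
    ((volume : Measure ℝ).withDensity fun c => ENNReal.ofReal c⁻¹)

/-- The chosen Haar measure on the centralizer `H₁ = Σ K₁ C` of a block diagonal matrix:
`∫ f dν̃₁ = ∑_{σ ∈ Σ} ∫_{K₁ × C} f(σ k c) dθ(k) dc`. -/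
def haarModel {n r₁ r₂ : ℕ} (hn : r₁ + r₂ * 2 = n) (b : Fin r₁ → ℝ) (w : Fin r₂ → ℂ) :
    Measure (torus (blockMatrix hn b w)) :=
  ∑ ε : Fin r₁ → ℤˣ,
    ((rotationMeasure r₂).prod (scalingMeasure (r₁ + r₂ - 1))).map
      (fun p => signPoint hn b w ε * rotationPoint hn b w p.1 * scalingPoint hn b w p.2)

/-- The block diagonal matrix `X₁ = diag(d_1, …, d_{r₁+r₂})` with `d_i = σ_i(α)` for `i ≤ r₁` and
`d_i = (x, -y; y, x)` for `i > r₁`, where `σ_i(α) = x + i y`. -/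
def modelMatrix {K : Type*} [Field K] {n r₁ r₂ : ℕ} (hn : r₁ + r₂ * 2 = n)
    (σ : EmbeddingNumbering K r₁ r₂) (α : K) : Matrix (Fin n) (Fin n) ℝ :=
  blockMatrix hn (fun i => σ.real i α) (fun j => σ.cplx j α)

/-- The chosen Haar measure `ν̃₁` on the centralizer `H₁` of `X₁`. -/
def haarH₁ {K : Type*} [Field K] {n r₁ r₂ : ℕ} (hn : r₁ + r₂ * 2 = n)
    (σ : EmbeddingNumbering K r₁ r₂) (α : K) : Measure (torus (modelMatrix hn σ α)) :=
  haarModel hn (fun i => σ.real i α) (fun j => σ.cplx j α)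

/-- The chosen Haar measure `ν̃` on the centralizer `H` of `X`, the one with `ψ_* ν̃ = ν̃₁` for
`ψ(h) = g₀ h g₀⁻¹`. -/
def haarH {K : Type*} [Field K] {n r₁ r₂ : ℕ} (hn : r₁ + r₂ * 2 = n)
    (σ : EmbeddingNumbering K r₁ r₂) (α : K) {X : Matrix (Fin n) (Fin n) ℝ} (g₀ : GL (Fin n) ℝ)
    (hg : (g₀ : Matrix (Fin n) (Fin n) ℝ) * X *
      ((g₀⁻¹ : GL (Fin n) ℝ) : Matrix (Fin n) (Fin n) ℝ) = modelMatrix hn σ α) :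
    Measure (torus X) :=
  (haarH₁ hn σ α).map (conjTorus g₀ hg).symm

/-- `ν` is the measure on `H/Λ` corresponding to the measure `ν'` on `H` (and to the counting
measure on `Λ`): `∫_H f dν' = ∫_{H/Λ} (∑_{h ∈ x} f(h)) dν(x)` for all Borel `f ≥ 0`, where the inner
sum is over the coset `x = gΛ`, i.e. it is `∑_{λ ∈ Λ} f(gλ)`. -/
def IsQuotientMeasure {H : Type*} [Group H] [MeasurableSpace H] (Λ : Subgroup H)
    (ν' : Measure H) (ν : Measure (H ⧸ Λ)) : Prop :=
  ∀ f : H → ENNReal, Measurable f →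
    ∫⁻ h, f h ∂ν' = ∫⁻ x, (∑' h : {h : H // (h : H ⧸ Λ) = x}, f h) ∂ν

/-! ### Orders, their units and regulators -/

/-- The order `{β ∈ K : β M ⊆ M}` of a lattice `M` in `K`. -/
def orderOfLattice {K : Type*} [Field K] (M : Submodule ℤ K) : Subring K where
  carrier := {β | ∀ x ∈ M, β * x ∈ M}
  one_mem' := fun x hx => by simpa using hx
  zero_mem' := fun x _ => by simp
  mul_mem' := fun {a b} ha hb x hx => by
    rw [mul_assoc]
    exact ha _ (hb _ hx)
  add_mem' := fun {a b} ha hb x hx => by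
    rw [add_mul]
    exact add_mem (ha _ hx) (hb _ hx)
  neg_mem' := fun {a} ha x hx => by
    rw [neg_mul]
    exact neg_mem (ha _ hx)

/-- `w_𝔒`, the number of roots of unity in `𝔒`. -/
def numRootsOfUnity {K : Type*} [Field K] (O : Subring K) : ℕ :=
  Nat.card (CommGroup.torsion Oˣ)

/-- `ε_1, …, ε_m` is a system of fundamental units of `𝔒`: each unit is, in exactly one way, a root
of unity times a product of integral powers of the `ε_j`. -/
def IsFundamentalSystem {K : Type*} [Field K] (O : Subring K) {m : ℕ} (ε : Fin m → Oˣ) : Prop :=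
  ∀ u : Oˣ, ∃! p : CommGroup.torsion Oˣ × (Fin m → ℤ), u = (p.1 : Oˣ) * ∏ j, ε j ^ p.2 j

/-- `ν_i log |σ_i(x)|` for `1 ≤ i ≤ r₁ + r₂`, where `ν_i = 1` if `i ≤ r₁` and `ν_i = 2`
otherwise. -/
def logCoord {K : Type*} [Field K] {r₁ r₂ : ℕ} (σ : EmbeddingNumbering K r₁ r₂) (x : K) :
    Fin (r₁ + r₂) → ℝ :=
  Fin.addCases (fun i => Real.log |σ.real i x|) (fun j => 2 * Real.log ‖σ.cplx j x‖)

/-- `|det (ν_i log |σ_i(ε_j)|)_{1 ≤ i, j ≤ r₁ + r₂ - 1}|`; this is the regulator `R_𝔒` when the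
`ε_j` form a system of fundamental units of `𝔒`. -/
def regulatorOf {K : Type*} [Field K] {r₁ r₂ : ℕ} (σ : EmbeddingNumbering K r₁ r₂)
    {O : Subring K} (ε : Fin (r₁ + r₂ - 1) → Oˣ) : ℝ :=
  |(Matrix.of fun i j : Fin (r₁ + r₂ - 1) =>
    logCoord σ ((ε j : O) : K) (Fin.castLE (Nat.sub_le _ _) i)).det|

/-- `R` is the regulator of the order `𝔒`: systems of fundamental units of `𝔒` exist, and each of
them has regulator `R`. -/
def IsRegulator {K : Type*} [Field K] {r₁ r₂ : ℕ} (σ : EmbeddingNumbering K r₁ r₂)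
    (O : Subring K) (R : ℝ) : Prop :=
  (∃ ε : Fin (r₁ + r₂ - 1) → Oˣ, IsFundamentalSystem O ε) ∧
    ∀ ε : Fin (r₁ + r₂ - 1) → Oˣ, IsFundamentalSystem O ε → regulatorOf σ ε = R

end CentralizerTorus

end

namespace CentralizerTorus

/-! ### Unfolding over a countable subgroup -/

section QuotientMeasure

variable {H : Type*} [Group H]

/-! Polar decomposition of the blocks identifies `H₁` with `{±1}^r₁ × (ℝ/ℤ)^r₂ × ℝ^(r₁+r₂-1)`, the
last factor recording the free logarithms `ν_i log |λ_i|`; the remaining one is minus their sum,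
because the determinant is `±1`. In these coordinates the chosen Haar measure is counting measure
times a probability measure times Lebesgue measure (`haarModel_eq`), so the preimage under `freeLog`
of a Borel set `D` has measure `2 ^ r₁ * volume D`.

The lattice `H₁ ∩ Γ₁` is the unit group of the order. An integral matrix commuting with `X₀` is a
rational polynomial in `X₀`, since the characteristic polynomial is irreducible over `ℚ`; hence it
acts on the eigenvector `ω` as an element of `K` preserving the lattice, and its inverse does so as
well. Conversely, multiplication by a unit in the ℚ-basis `ω` is such a matrix. After conjugation by
`g₀` it becomes the block matrix of the embeddings of the unit, and its free logarithms form a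
column of the regulator matrix.

Let `D` be the fundamental parallelotope of the logarithms of a fundamental system and `F` its
preimage in `H₁`. Then `F` has measure `2 ^ r₁ * R`. A coset of the lattice meets `F` in exactly `w`
points: the exponents of the fundamental units are forced by the floor function, while the root of
unity is free, as it has zero logarithms. Unfolding (`isQuotientMeasure_iff`) then shows that the
quotient measure exists, is unique and has total mass `2 ^ r₁ * R / w`. Conjugation carries the
result to `H`.

Fundamental systems exist because the order contains a nonzero integer multiple of the maximal
order, so its units have finite index in those of the field. Every such system has the same
regulator, namely the regulator of `K` times the index of `𝔒ˣ · μ_K` in the units of `K`. -/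

theorem tsum_fiber_mk (Λ : Subgroup H) (f : H → ENNReal) (g : H) :
    ∑' h : {h : H // (h : H ⧸ Λ) = (g : H ⧸ Λ)}, f h = ∑' l : Λ, f (g * l) := by
  let e : Λ ≃ {h : H // (h : H ⧸ Λ) = (g : H ⧸ Λ)} :=
    { toFun := fun l => ⟨g * l, by
        rw [eq_comm, QuotientGroup.eq]
        simp⟩
      invFun := fun h => ⟨g⁻¹ * h, QuotientGroup.eq.1 h.2.symm⟩
      left_inv := fun l => by simp
      right_inv := fun h => by simp }
  exact (e.tsum_eq fun h : {h : H // (h : H ⧸ Λ) = (g : H ⧸ Λ)} => f h).symm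

variable [MeasurableSpace H]

theorem measurable_tsum_fiber (Λ : Subgroup H) [Countable Λ]
    (hm : ∀ l : Λ, Measurable fun h : H => h * l) {f : H → ENNReal} (hf : Measurable f) :
    Measurable fun x : H ⧸ Λ => ∑' h : {h : H // (h : H ⧸ Λ) = x}, f h := by
  refine QuotientGroup.measurable_from_quotient.2 ?_
  have : (fun x : H ⧸ Λ => ∑' h : {h : H // (h : H ⧸ Λ) = x}, f h) ∘ ((↑) : H → H ⧸ Λ) =
      fun g => ∑' l : Λ, f (g * l) := funext fun g => tsum_fiber_mk Λ f g
  rw [this]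
  exact Measurable.tsum fun l => hf.comp (hm l)

/-- A Borel set that meets each coset of a countable group `Λ` in exactly `w` points determines
the measure on the coset space. -/
theorem isQuotientMeasure_iff (Λ : Subgroup H) [Countable Λ] (μ : Measure H)
    (hm : ∀ l : Λ, Measurable fun h : H => h * l)
    (hinv : ∀ l : Λ, μ.map (fun h : H => h * l) = μ)
    {F : Set H} (hF : MeasurableSet F) {w : ENNReal} (hw0 : w ≠ 0) (hwt : w ≠ ⊤)
    (hcount : ∀ h : H, ∑' l : Λ, F.indicator 1 (h * l) = w) (ν : Measure (H ⧸ Λ)) :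
    IsQuotientMeasure Λ μ ν ↔
      ν = w⁻¹ • (μ.restrict F).map (QuotientGroup.mk : H → H ⧸ Λ) := by
  have hmk : Measurable (QuotientGroup.mk : H → H ⧸ Λ) := QuotientGroup.measurable_coe
  constructor
  · intro h
    ext A hA
    have hA' : MeasurableSet ((QuotientGroup.mk : H → H ⧸ Λ) ⁻¹' A) := hmk hA
    -- Testing against the indicator of `F ∩ π⁻¹ A` gives the fibre sum `w · 1_A`, hence `μ (F ∩ π⁻¹
    -- A) = w * ν A`, which forces `ν`.
    have h1 := h ((F ∩ (QuotientGroup.mk : H → H ⧸ Λ) ⁻¹' A).indicator 1)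
      (measurable_one.indicator (hF.inter hA'))
    rw [lintegral_indicator_one (hF.inter hA')] at h1
    have h2 : ∀ x : H ⧸ Λ, ∑' h : {h : H // (h : H ⧸ Λ) = x},
        (F ∩ (QuotientGroup.mk : H → H ⧸ Λ) ⁻¹' A).indicator (1 : H → ENNReal) h =
        A.indicator (fun _ => w) x := by
      intro x
      induction x using QuotientGroup.induction_on with
      | H g =>
        rw [tsum_fiber_mk]
        by_cases hg : (g : H ⧸ Λ) ∈ A
        · rw [Set.indicator_of_mem hg, ← hcount g]
          refine tsum_congr fun l => ?_
          have : g * l ∈ (QuotientGroup.mk : H → H ⧸ Λ) ⁻¹' A := by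
            simpa [Set.mem_preimage] using hg
          by_cases hl : g * (l : H) ∈ F
          · rw [Set.indicator_of_mem (Set.mem_inter hl this), Set.indicator_of_mem hl]
          · rw [Set.indicator_of_notMem fun h => hl h.1, Set.indicator_of_notMem hl]
        · rw [Set.indicator_of_notMem hg, ENNReal.tsum_eq_zero]
          intro l
          refine Set.indicator_of_notMem (fun h => hg ?_) _
          simpa [Set.mem_preimage] using h.2
    simp_rw [h2] at h1
    rw [lintegral_indicator_const hA] at h1
    rw [Measure.smul_apply, Measure.map_apply hmk hA, Measure.restrict_apply hA', Set.inter_comm,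
      h1, smul_eq_mul, ← mul_assoc, ENNReal.inv_mul_cancel hw0 hwt, one_mul]
  · rintro rfl f hf
    rw [lintegral_smul_measure, lintegral_map (measurable_tsum_fiber Λ hm hf) hmk]
    simp_rw [tsum_fiber_mk]
    rw [lintegral_tsum (f := fun (l : Λ) (h : H) => f (h * l))
      fun l => (hf.comp (hm l)).aemeasurable]
    -- Right invariance moves the translation by `l` from `f` onto `F`. Summed over `l`, the
    -- translates of the indicator of `F` give the constant `w`.
    have h1 : ∀ l : Λ, ∫⁻ h in F, f (h * l) ∂μ =
        ∫⁻ h, F.indicator 1 (h * ((l⁻¹ : Λ) : H)) * f h ∂μ := by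
      intro l
      have h2 : Measurable fun h : H => F.indicator (1 : H → ENNReal) (h * ((l⁻¹ : Λ) : H)) * f h :=
        ((measurable_one.indicator hF).comp (hm l⁻¹)).mul hf
      conv_rhs => rw [← hinv l]
      rw [lintegral_map h2 (hm l), ← lintegral_indicator hF]
      refine lintegral_congr fun h => ?_
      simp only [InvMemClass.coe_inv, mul_inv_cancel_right]
      by_cases hh : h ∈ F <;> simp [hh]
    simp_rw [h1]
    rw [← lintegral_tsum
      (f := fun (l : Λ) (h : H) => F.indicator (1 : H → ENNReal) (h * ((l⁻¹ : Λ) : H)) * f h)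
      fun l => (((measurable_one.indicator hF).comp (hm l⁻¹)).mul hf).aemeasurable]
    simp_rw [ENNReal.tsum_mul_right]
    have h3 : ∀ h : H, ∑' l : Λ, F.indicator (1 : H → ENNReal) (h * ((l⁻¹ : Λ) : H)) = w :=
      fun h => by
        rw [← hcount h]
        exact (Equiv.inv Λ).tsum_eq fun l : Λ => F.indicator (1 : H → ENNReal) (h * l)
    simp_rw [h3]
    rw [lintegral_const_mul _ hf, smul_eq_mul, ← mul_assoc, ENNReal.inv_mul_cancel hw0 hwt,
      one_mul]

end QuotientMeasure

/-! ### Signs, angles and logarithms as coordinates on `Σ K₁ C` -/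

section PolarCoordinates

/-- The coordinatewise exponential `ℝ^m → (0, ∞)^m`. -/
noncomputable def expCoord {m : ℕ} (x : Fin m → ℝ) (i : Fin m) : Set.Ioi (0 : ℝ) :=
  ⟨Real.exp (x i), Real.exp_pos _⟩

theorem continuous_expCoord {m : ℕ} : Continuous (expCoord : (Fin m → ℝ) → _) :=
  continuous_pi fun i => (Real.continuous_exp.comp (continuous_apply i)).subtype_mk _

theorem fullCoord_expCoord_add {m : ℕ} (x y : Fin m.pred → ℝ) (i : Fin m) :
    fullCoord (expCoord (x + y)) i = fullCoord (expCoord x) i * fullCoord (expCoord y) i := by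
  unfold fullCoord
  split_ifs
  · simp [expCoord, Real.exp_add]
  · simp only [expCoord, Pi.add_apply, Real.exp_add, Finset.prod_mul_distrib, mul_inv]

theorem continuous_fullCoord {m : ℕ} (i : Fin m) :
    Continuous fun c : Fin (m - 1) → Set.Ioi (0 : ℝ) => fullCoord c i := by
  unfold fullCoord
  split_ifs with h
  · exact continuous_subtype_val.comp (continuous_apply _)
  · refine Continuous.inv₀ (continuous_finsetProd _ fun j _ =>
      continuous_subtype_val.comp (continuous_apply j)) fun c => ?_
    exact (Finset.prod_pos fun j _ => (c j).2).ne'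

/-- The substitution `c = exp x`, with `dc = exp x dx`, turns `dc / c` into Lebesgue measure. -/
theorem map_exp_volume : (volume : Measure ℝ).map
      (fun x => (⟨Real.exp x, Real.exp_pos x⟩ : Set.Ioi (0 : ℝ))) =
    Measure.comap Subtype.val ((volume : Measure ℝ).withDensity fun c => ENNReal.ofReal c⁻¹) := by
  have hm : Measurable fun x : ℝ => (⟨Real.exp x, Real.exp_pos x⟩ : Set.Ioi (0 : ℝ)) :=
    Real.measurable_exp.subtype_mk
  ext s hs
  have hs' : MeasurableSet (Subtype.val '' s : Set ℝ) :=
    (MeasurableEmbedding.subtype_coe measurableSet_Ioi).measurableSet_image.2 hs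
  rw [Measure.map_apply hm hs,
    (MeasurableEmbedding.subtype_coe measurableSet_Ioi).comap_apply,
    withDensity_apply _ hs']
  have h : (Subtype.val '' s : Set ℝ) = Real.exp ''
      ((fun x => (⟨Real.exp x, Real.exp_pos x⟩ : Set.Ioi (0 : ℝ))) ⁻¹' s) := by
    ext y
    constructor
    · rintro ⟨y, hy, rfl⟩
      exact ⟨Real.log y, by simpa [Real.exp_log y.2] using hy, Real.exp_log y.2⟩
    · rintro ⟨x, hx, rfl⟩
      exact ⟨_, hx, rfl⟩
  rw [h, lintegral_image_eq_lintegral_abs_deriv_mul (hm hs)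
    (fun x _ => (Real.hasDerivAt_exp x).hasDerivWithinAt) Real.exp_injective.injOn]
  have h2 : ∀ x : ℝ, ENNReal.ofReal |Real.exp x| * ENNReal.ofReal (Real.exp x)⁻¹ = 1 := fun x => by
    rw [← ENNReal.ofReal_mul (abs_nonneg _), abs_of_pos (Real.exp_pos x),
      mul_inv_cancel₀ (Real.exp_pos x).ne', ENNReal.ofReal_one]
  simp_rw [h2]
  simp

theorem scalingMeasure_eq_map (m : ℕ) :
    scalingMeasure m = (volume : Measure (Fin m → ℝ)).map expCoord := by
  have hm : Measurable fun x : ℝ => (⟨Real.exp x, Real.exp_pos x⟩ : Set.Ioi (0 : ℝ)) :=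
    Real.measurable_exp.subtype_mk
  unfold scalingMeasure
  simp_rw [← map_exp_volume]
  -- Commuting push-forward with products needs σ-finite factors; this holds because `exp` is a
  -- homeomorphism onto `(0, ∞)`.
  have : SigmaFinite ((volume : Measure ℝ).map
      (fun x => (⟨Real.exp x, Real.exp_pos x⟩ : Set.Ioi (0 : ℝ)))) := by
    let e : ℝ ≃ᵐ Set.Ioi (0 : ℝ) := Real.expOrderIso.toHomeomorph.toMeasurableEquiv
    exact e.sigmaFinite_map
  rw [volume_pi, ← Measure.pi_map_pi fun _ => hm.aemeasurable]
  rfl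

variable {n r₁ r₂ : ℕ} (hn : r₁ + r₂ * 2 = n) (b : Fin r₁ → ℝ) (w : Fin r₂ → ℂ)

theorem continuous_blockMatrix {T : Type*} [TopologicalSpace T] {a : T → Fin r₁ → ℝ}
    {z : T → Fin r₂ → ℂ} (ha : Continuous a) (hz : Continuous z) :
    Continuous fun t => blockMatrix hn (a t) (z t) := by
  have hz' : ∀ j, Continuous fun t => z t j := fun j => (continuous_apply j).comp hz
  refine Continuous.matrix_reindex ?_ _ _
  refine Continuous.matrix_fromBlocks ha.matrix_diagonal continuous_const continuous_const
    (Continuous.matrix_blockDiagonal (continuous_pi fun j => ?_))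
  refine continuous_matrix fun s t => ?_
  have h1 := Complex.continuous_re.comp (hz' j)
  have h2 := Complex.continuous_im.comp (hz' j)
  fin_cases s <;> fin_cases t
  exacts [h1, h2.neg, h2, h1]

theorem blockMatrix_one : blockMatrix hn (1 : Fin r₁ → ℝ) (1 : Fin r₂ → ℂ) = 1 := by
  unfold blockMatrix
  have : (fun j : Fin r₂ => !![((1 : Fin r₂ → ℂ) j).re, -((1 : Fin r₂ → ℂ) j).im;
      ((1 : Fin r₂ → ℂ) j).im, ((1 : Fin r₂ → ℂ) j).re]) = 1 := by
    funext j
    ext s t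
    fin_cases s <;> fin_cases t <;> simp
  rw [this, Matrix.blockDiagonal_one, Matrix.diagonal_one', Matrix.fromBlocks_one]
  simp

theorem coe_torusPoint (a : Fin r₁ → ℝ) (z : Fin r₂ → ℂ) (h) :
    ((torusPoint hn b w a z h : GL (Fin n) ℝ) : Matrix (Fin n) (Fin n) ℝ) = blockMatrix hn a z :=
  rfl

theorem torus_ext {X : Matrix (Fin n) (Fin n) ℝ} {g h : torus X}
    (e : ((g : GL (Fin n) ℝ) : Matrix (Fin n) (Fin n) ℝ) = (h : GL (Fin n) ℝ)) : g = h :=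
  Subtype.ext (Units.ext e)

theorem ne_zero_of_norm_prod_eq_one {a : Fin r₁ → ℝ} {z : Fin r₂ → ℂ}
    (h : |∏ i, a i| * ∏ j, ‖z j‖ ^ 2 = 1) : (∀ i, a i ≠ 0) ∧ ∀ j, z j ≠ 0 := by
  constructor
  · intro i hi
    rw [Finset.prod_eq_zero (Finset.mem_univ i) hi] at h
    simp at h
  · intro j hj
    rw [Finset.prod_eq_zero (Finset.mem_univ j) (by simp [hj] : ‖z j‖ ^ 2 = 0)] at h
    simp at h

theorem continuous_torusPoint {T : Type*} [TopologicalSpace T] {a : T → Fin r₁ → ℝ}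
    {z : T → Fin r₂ → ℂ} (ha : Continuous a) (hz : Continuous z)
    (h : ∀ t, |∏ i, a t i| * ∏ j, ‖z t j‖ ^ 2 = 1) :
    Continuous fun t => torusPoint hn b w (a t) (z t) (h t) := by
  refine Continuous.subtype_mk (Units.continuous_iff.2 ⟨continuous_blockMatrix hn ha hz, ?_⟩) _
  -- The topology on `GL` also requires continuity of the inverse, which is again block diagonal,
  -- with inverted blocks.
  have e : ∀ t, (((torusPoint hn b w (a t) (z t) (h t) : GL (Fin n) ℝ)⁻¹ : GL (Fin n) ℝ) :
      Matrix (Fin n) (Fin n) ℝ) =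
      blockMatrix hn (fun i => (a t i)⁻¹) (fun j => (z t j)⁻¹) := by
    intro t
    obtain ⟨h1, h2⟩ := ne_zero_of_norm_prod_eq_one (h t)
    rw [Units.inv_eq_of_mul_eq_one_right]
    rw [coe_torusPoint, blockMatrix_mul, ← blockMatrix_one hn]
    congr 1
    · funext i
      simp [h1 i]
    · funext j
      simp [h2 j]
  refine (continuous_blockMatrix hn (continuous_pi fun i => ?_)
    (continuous_pi fun j => ?_)).congr fun t => (e t).symm
  · exact ((continuous_apply i).comp ha).inv₀ fun t => (ne_zero_of_norm_prod_eq_one (h t)).1 i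
  · exact ((continuous_apply j).comp hz).inv₀ fun t => (ne_zero_of_norm_prod_eq_one (h t)).2 j

/-- The element `σ k c` of `Σ K₁ C` in terms of the signs, the angles and the logarithms of the
free coordinates of `c`. -/
noncomputable def polarPoint (ε : Fin r₁ → ℤˣ) (θ : Fin r₂ → UnitAddCircle)
    (x : Fin (r₁ + r₂ - 1) → ℝ) : torus (blockMatrix hn b w) :=
  signPoint hn b w ε * rotationPoint hn b w θ * scalingPoint hn b w (expCoord x)

theorem coe_polarPoint (ε : Fin r₁ → ℤˣ) (θ : Fin r₂ → UnitAddCircle)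
    (x : Fin (r₁ + r₂ - 1) → ℝ) :
    ((polarPoint hn b w ε θ x : GL (Fin n) ℝ) : Matrix (Fin n) (Fin n) ℝ) =
      blockMatrix hn (fun i => ((ε i : ℤ) : ℝ) * fullCoord (expCoord x) (Fin.castAdd r₂ i))
        (fun j => (AddCircle.toCircle (θ j) : ℂ) *
          (Real.sqrt (fullCoord (expCoord x) (Fin.natAdd r₁ j)) : ℂ)) := by
  change blockMatrix hn _ _ * blockMatrix hn _ _ * blockMatrix hn _ _ = _
  rw [blockMatrix_mul, blockMatrix_mul]
  congr 1
  · funext i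
    simp
  · funext j
    simp

/-- All the blocks commute, so the parametrization is a homomorphism. Invariance of the measure
thereby reduces to permuting signs and translating angles and logarithms. -/
theorem polarPoint_mul (ε ε' : Fin r₁ → ℤˣ) (θ θ' : Fin r₂ → UnitAddCircle)
    (x x' : Fin (r₁ + r₂ - 1) → ℝ) :
    polarPoint hn b w ε θ x * polarPoint hn b w ε' θ' x' =
      polarPoint hn b w (ε * ε') (θ + θ') (x + x') := by
  refine torus_ext ?_
  rw [Subgroup.coe_mul, Units.val_mul, coe_polarPoint, coe_polarPoint, coe_polarPoint,
    blockMatrix_mul]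
  congr 1
  · funext i
    simp only [Pi.mul_apply]
    rw [fullCoord_expCoord_add]
    push_cast
    ring
  · funext j
    simp only [Pi.mul_apply, Pi.add_apply]
    rw [fullCoord_expCoord_add, Real.sqrt_mul (fullCoord_pos _ _).le, AddCircle.toCircle_add]
    push_cast
    ring

theorem continuous_polarPoint (ε : Fin r₁ → ℤˣ) :
    Continuous fun p : (Fin r₂ → UnitAddCircle) × (Fin (r₁ + r₂ - 1) → ℝ) =>
      polarPoint hn b w ε p.1 p.2 := by
  refine ((continuous_const.mul ?_).mul ?_)
  · refine continuous_torusPoint hn b w continuous_const (continuous_pi fun j => ?_) _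
    exact continuous_subtype_val.comp (AddCircle.continuous_toCircle.comp
      ((continuous_apply j).comp continuous_fst))
  · refine continuous_torusPoint hn b w (continuous_pi fun i => ?_) (continuous_pi fun j => ?_) _
    · exact (continuous_fullCoord _).comp (continuous_expCoord.comp continuous_snd)
    · exact Complex.continuous_ofReal.comp (Real.continuous_sqrt.comp
        ((continuous_fullCoord _).comp (continuous_expCoord.comp continuous_snd)))

theorem continuous_scaled_sign (ε : Fin r₁ → ℤˣ) :
    Continuous fun p : (Fin r₂ → UnitAddCircle) × (Fin (r₁ + r₂ - 1) → Set.Ioi (0 : ℝ)) =>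
      signPoint hn b w ε * rotationPoint hn b w p.1 * scalingPoint hn b w p.2 := by
  refine ((continuous_const.mul ?_).mul ?_)
  · refine continuous_torusPoint hn b w continuous_const (continuous_pi fun j => ?_) _
    exact continuous_subtype_val.comp (AddCircle.continuous_toCircle.comp
      ((continuous_apply j).comp continuous_fst))
  · refine continuous_torusPoint hn b w (continuous_pi fun i => ?_) (continuous_pi fun j => ?_) _
    · exact (continuous_fullCoord _).comp continuous_snd
    · exact Complex.continuous_ofReal.comp (Real.continuous_sqrt.comp
        ((continuous_fullCoord _).comp continuous_snd))

end PolarCoordinates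

/-! ### The Haar measure in polar coordinates -/

section HaarModel

variable {n r₁ r₂ : ℕ} (hn : r₁ + r₂ * 2 = n) (b : Fin r₁ → ℝ) (w : Fin r₂ → ℂ)

instance isAddLeftInvariant_rotationMeasure (r : ℕ) :
    (rotationMeasure r).IsAddLeftInvariant := by
  unfold rotationMeasure
  infer_instance

instance isProbabilityMeasure_rotationMeasure (r : ℕ) :
    IsProbabilityMeasure (rotationMeasure r) := by
  unfold rotationMeasure
  infer_instance

theorem haarModel_eq : haarModel hn b w = ∑ ε : Fin r₁ → ℤˣ,
    ((rotationMeasure r₂).prod (volume : Measure (Fin (r₁ + r₂ - 1) → ℝ))).map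
      (fun p => polarPoint hn b w ε p.1 p.2) := by
  unfold haarModel
  refine Finset.sum_congr rfl fun ε _ => ?_
  rw [scalingMeasure_eq_map]
  conv_lhs => rw [← Measure.map_id (μ := rotationMeasure r₂)]
  have : SFinite ((volume : Measure (Fin (r₁ + r₂ - 1) → ℝ)).map expCoord) := inferInstance
  rw [Measure.map_prod_map _ _ measurable_id continuous_expCoord.measurable,
    Measure.map_map (continuous_scaled_sign hn b w ε).measurable
      (measurable_id.prodMap continuous_expCoord.measurable)]
  rfl

theorem measurable_polarPoint (ε : Fin r₁ → ℤˣ) :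
    Measurable fun p : (Fin r₂ → UnitAddCircle) × (Fin (r₁ + r₂ - 1) → ℝ) =>
      polarPoint hn b w ε p.1 p.2 :=
  (continuous_polarPoint hn b w ε).measurable

/-- Multiplication by a polar point permutes the sign components and translates the other two
factors, whose measures are translation invariant. -/
theorem map_haarModel_mul_polarPoint (ε : Fin r₁ → ℤˣ) (θ : Fin r₂ → UnitAddCircle)
    (x : Fin (r₁ + r₂ - 1) → ℝ) :
    (haarModel hn b w).map (fun h => h * polarPoint hn b w ε θ x) = haarModel hn b w := by
  have hm : Measurable fun h : torus (blockMatrix hn b w) => h * polarPoint hn b w ε θ x :=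
    (continuous_mul_const _).measurable
  rw [haarModel_eq, ← Measure.mapₗ_apply_of_measurable hm, map_sum]
  refine Fintype.sum_equiv (Equiv.mulRight ε) _ _ fun ε' => ?_
  rw [Measure.mapₗ_apply_of_measurable hm, Measure.map_map hm (measurable_polarPoint hn b w ε')]
  have e : (fun h => h * polarPoint hn b w ε θ x) ∘ (fun p => polarPoint hn b w ε' p.1 p.2) =
      (fun p => polarPoint hn b w (ε' * ε) p.1 p.2) ∘ Prod.map (θ + ·) (x + ·) := by
    funext p
    simp only [Function.comp_apply, polarPoint_mul, Prod.map_fst, Prod.map_snd]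
    rw [add_comm p.1, add_comm p.2]
  rw [e, ← Measure.map_map (measurable_polarPoint hn b w _)
      ((measurable_const_add θ).prodMap (measurable_const_add x)),
    ← Measure.map_prod_map _ _ (measurable_const_add θ) (measurable_const_add x),
    map_add_left_eq_self, map_add_left_eq_self]
  rfl

/-- `ν_i log |λ_i|` for the eigenvalues `λ_i` of a block diagonal matrix, one from each pair of
complex conjugate ones. -/
noncomputable def blockLog (M : Matrix (Fin n) (Fin n) ℝ) : Fin (r₁ + r₂) → ℝ :=
  Fin.addCases (fun i => Real.log |M (blockIndex hn (Sum.inl i)) (blockIndex hn (Sum.inl i))|)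
    (fun j => 2 * Real.log ‖(⟨M (blockIndex hn (Sum.inr (0, j))) (blockIndex hn (Sum.inr (0, j))),
      M (blockIndex hn (Sum.inr (1, j))) (blockIndex hn (Sum.inr (0, j)))⟩ : ℂ)‖)

theorem blockLog_blockMatrix_castAdd (a : Fin r₁ → ℝ) (z : Fin r₂ → ℂ) (i : Fin r₁) :
    blockLog hn (blockMatrix hn a z) (Fin.castAdd r₂ i) = Real.log |a i| := by
  simp [blockLog, blockMatrix]

theorem blockLog_blockMatrix_natAdd (a : Fin r₁ → ℝ) (z : Fin r₂ → ℂ) (j : Fin r₂) :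
    blockLog hn (blockMatrix hn a z) (Fin.natAdd r₁ j) = 2 * Real.log ‖z j‖ := by
  simp [blockLog, blockMatrix, Matrix.blockDiagonal_apply]

theorem sum_blockLog (a : Fin r₁ → ℝ) (z : Fin r₂ → ℂ)
    (h : |∏ i, a i| * ∏ j, ‖z j‖ ^ 2 = 1) : ∑ i, blockLog hn (blockMatrix hn a z) i = 0 := by
  obtain ⟨h1, h2⟩ := ne_zero_of_norm_prod_eq_one h
  rw [Fin.sum_univ_add]
  simp only [blockLog_blockMatrix_castAdd, blockLog_blockMatrix_natAdd]
  rw [← Real.log_one, ← h, Finset.abs_prod, Real.log_mul, Real.log_prod, Real.log_prod]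
  · simp
  · intro j _
    simpa using h2 j
  · intro i _
    simpa using h1 i
  · exact Finset.prod_ne_zero_iff.2 fun i _ => by simpa using h1 i
  · exact Finset.prod_ne_zero_iff.2 fun j _ => by simpa using h2 j

/-- The first `r₁ + r₂ - 1` coordinates of `blockLog`. -/
noncomputable def freeLog (M : Matrix (Fin n) (Fin n) ℝ) (i : Fin (r₁ + r₂ - 1)) : ℝ :=
  blockLog hn M (Fin.castLE (Nat.sub_le _ _) i)

theorem blockLog_mul {a a' : Fin r₁ → ℝ} {z z' : Fin r₂ → ℂ}
    (h : |∏ i, a i| * ∏ j, ‖z j‖ ^ 2 = 1) (h' : |∏ i, a' i| * ∏ j, ‖z' j‖ ^ 2 = 1) :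
    blockLog hn (blockMatrix hn a z * blockMatrix hn a' z') =
      blockLog hn (blockMatrix hn a z) + blockLog hn (blockMatrix hn a' z') := by
  obtain ⟨h1, h2⟩ := ne_zero_of_norm_prod_eq_one h
  obtain ⟨h1', h2'⟩ := ne_zero_of_norm_prod_eq_one h'
  rw [blockMatrix_mul]
  funext i
  refine Fin.addCases (fun i => ?_) (fun j => ?_) i
  · simp [blockLog_blockMatrix_castAdd, abs_mul, Real.log_mul (abs_ne_zero.2 (h1 i)) (abs_ne_zero.2 (h1' i))]
  · simp [blockLog_blockMatrix_natAdd, Real.log_mul (norm_ne_zero_iff.2 (h2 j)) (norm_ne_zero_iff.2 (h2' j)), mul_add]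

theorem measurable_freeLog {X : Matrix (Fin n) (Fin n) ℝ} :
    Measurable fun h : torus X => freeLog (r₁ := r₁) (r₂ := r₂) hn (h : GL (Fin n) ℝ) := by
  have hc : Continuous fun h : torus X => ((h : GL (Fin n) ℝ) : Matrix (Fin n) (Fin n) ℝ) :=
    Units.continuous_val.comp continuous_subtype_val
  have hm : ∀ s t, Measurable fun h : torus X =>
      ((h : GL (Fin n) ℝ) : Matrix (Fin n) (Fin n) ℝ) s t :=
    fun s t => (hc.matrix_elem s t).measurable
  have key : ∀ i, Measurable fun h : torus X =>
      blockLog (r₁ := r₁) (r₂ := r₂) hn (h : GL (Fin n) ℝ) i := by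
    intro i
    refine Fin.addCases (fun i => ?_) (fun j => ?_) i
    · simp only [blockLog, Fin.addCases_left]
      exact Real.measurable_log.comp (hm _ _).abs
    · simp only [blockLog, Fin.addCases_right]
      refine (Real.measurable_log.comp (Measurable.norm ?_)).const_mul 2
      exact Complex.measurableEquivRealProd.symm.measurable.comp ((hm _ _).prodMk (hm _ _))
  exact measurable_pi_lambda _ fun i => key _

theorem fullCoord_expCoord_castLE {m : ℕ} (x : Fin (m - 1) → ℝ) (i : Fin (m - 1)) :
    fullCoord (expCoord x) (Fin.castLE (Nat.sub_le _ _) i) = Real.exp (x i) := by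
  unfold fullCoord
  rw [dif_pos (by simp)]
  rfl

/-- The last coordinate of `fullCoord` is the inverse product of the others, that is `exp` of minus
the sum of their logarithms; the sum-zero condition makes this `exp` of the last `y`. -/
theorem fullCoord_expCoord_of_sum {m : ℕ} {y : Fin m → ℝ} (hy : ∑ i, y i = 0) (i : Fin m) :
    fullCoord (expCoord fun i => y (Fin.castLE (Nat.sub_le m 1) i)) i = Real.exp (y i) := by
  rcases m with _ | m
  · exact i.elim0
  · induction i using Fin.lastCases with
    | cast i => exact fullCoord_expCoord_castLE (m := m + 1) _ i
    | last =>
      rw [Fin.sum_univ_castSucc] at hy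
      unfold fullCoord
      rw [dif_neg (by simp)]
      simp only [expCoord]
      rw [← Real.exp_sum, ← Real.exp_neg]
      congr 1
      exact neg_eq_of_add_eq_zero_right hy

theorem blockLog_polarPoint (ε : Fin r₁ → ℤˣ) (θ : Fin r₂ → UnitAddCircle)
    (x : Fin (r₁ + r₂ - 1) → ℝ) (i : Fin (r₁ + r₂)) :
    blockLog hn (polarPoint hn b w ε θ x : GL (Fin n) ℝ) i =
      Real.log (fullCoord (expCoord x) i) := by
  rw [coe_polarPoint]
  refine Fin.addCases (fun i => ?_) (fun j => ?_) i
  · rw [blockLog_blockMatrix_castAdd, abs_mul, abs_of_pos (fullCoord_pos _ _)]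
    rcases Int.units_eq_one_or (ε i) with h | h <;> simp [h]
  · rw [blockLog_blockMatrix_natAdd, norm_mul, Circle.norm_coe, one_mul, Complex.norm_real,
      Real.norm_eq_abs, abs_of_nonneg (Real.sqrt_nonneg _), Real.log_sqrt (fullCoord_pos _ _).le]
    ring

theorem freeLog_polarPoint (ε : Fin r₁ → ℤˣ) (θ : Fin r₂ → UnitAddCircle)
    (x : Fin (r₁ + r₂ - 1) → ℝ) :
    freeLog hn (polarPoint hn b w ε θ x : GL (Fin n) ℝ) = x := by
  funext i
  rw [freeLog, blockLog_polarPoint, fullCoord_expCoord_castLE, Real.log_exp]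

theorem norm_prod_eq_one_of_mem {h : torus (blockMatrix hn b w)} {a : Fin r₁ → ℝ}
    {z : Fin r₂ → ℂ} (e : ((h : GL (Fin n) ℝ) : Matrix (Fin n) (Fin n) ℝ) = blockMatrix hn a z) :
    |∏ i, a i| * ∏ j, ‖z j‖ ^ 2 = 1 := by
  have hd : ((h : GL (Fin n) ℝ) : Matrix (Fin n) (Fin n) ℝ).det = 1 ∨
      ((h : GL (Fin n) ℝ) : Matrix (Fin n) (Fin n) ℝ).det = -1 := h.2.1
  rwa [← abs_eq zero_le_one, e, det_blockMatrix, abs_mul,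
    abs_of_nonneg (Finset.prod_nonneg fun j _ => sq_nonneg ‖z j‖)] at hd

/-- Write `a i = ± |a i|` and `z j = (z j / ‖z j‖) * ‖z j‖`. The scaling coordinate of a complex
block is `‖z j‖ ^ 2`, which explains both the factor `2` in `blockLog` and the square root in `C`.
-/
theorem exists_eq_polarPoint {h : torus (blockMatrix hn b w)} {a : Fin r₁ → ℝ}
    {z : Fin r₂ → ℂ} (e : ((h : GL (Fin n) ℝ) : Matrix (Fin n) (Fin n) ℝ) = blockMatrix hn a z) :
    ∃ ε θ x, h = polarPoint hn b w ε θ x := by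
  have hd := norm_prod_eq_one_of_mem hn b w e
  obtain ⟨h1, h2⟩ := ne_zero_of_norm_prod_eq_one hd
  have hs : ∀ i, ∃ ε : ℤˣ, a i = ((ε : ℤ) : ℝ) * |a i| := fun i => by
    rcases abs_choice (a i) with h | h
    · exact ⟨1, by simp [h]⟩
    · exact ⟨-1, by simp [h]⟩
  choose ε hε using hs
  have ht : ∀ j, ∃ θ : UnitAddCircle, z j = (AddCircle.toCircle θ : ℂ) * ‖z j‖ := fun j => by
    obtain ⟨θ, hθ⟩ := (AddCircle.homeomorphCircle (T := (1 : ℝ)) one_ne_zero).surjective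
      ⟨z j / ‖z j‖, by
        simp [Submonoid.unitSphere, norm_ne_zero_iff.2 (h2 j)]⟩
    refine ⟨θ, ?_⟩
    rw [← AddCircle.homeomorphCircle_apply one_ne_zero, hθ]
    have : (‖z j‖ : ℂ) ≠ 0 := by exact_mod_cast norm_ne_zero_iff.2 (h2 j)
    simp [this]
  choose θ hθ using ht
  refine ⟨ε, θ, freeLog hn (h : GL (Fin n) ℝ), torus_ext ?_⟩
  have hc := fullCoord_expCoord_of_sum (sum_blockLog hn a z hd)
  have hf : freeLog hn ((h : GL (Fin n) ℝ) : Matrix (Fin n) (Fin n) ℝ) =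
      fun i => blockLog hn (blockMatrix hn a z) (Fin.castLE (Nat.sub_le _ 1) i) := by
    rw [e]
    rfl
  rw [coe_polarPoint, hf, e]
  congr 1
  · funext i
    rw [hc, blockLog_blockMatrix_castAdd, Real.exp_log (abs_pos.2 (h1 i))]
    exact hε i
  · funext j
    rw [hc, blockLog_blockMatrix_natAdd, two_mul, Real.exp_add,
      Real.exp_log (norm_pos_iff.2 (h2 j)), ← sq, Real.sqrt_sq (norm_nonneg _)]
    exact hθ j

/-- Each of the `2 ^ r₁` sign components contributes `volume D`: the angles carry total mass `1` and
do not affect the logarithms. -/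
theorem haarModel_preimage_freeLog {D : Set (Fin (r₁ + r₂ - 1) → ℝ)} (hD : MeasurableSet D) :
    haarModel hn b w {h | freeLog hn (h : GL (Fin n) ℝ) ∈ D} = 2 ^ r₁ * volume D := by
  rw [haarModel_eq, Measure.finsetSum_apply]
  have : ∀ ε : Fin r₁ → ℤˣ, (((rotationMeasure r₂).prod
      (volume : Measure (Fin (r₁ + r₂ - 1) → ℝ))).map
      (fun p => polarPoint hn b w ε p.1 p.2)) {h | freeLog hn (h : GL (Fin n) ℝ) ∈ D} =
      volume D := by
    intro ε
    rw [Measure.map_apply (measurable_polarPoint hn b w ε) (show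
      MeasurableSet {h : torus (blockMatrix hn b w) | freeLog hn (h : GL (Fin n) ℝ) ∈ D} from
        measurable_freeLog hn hD)]
    have e : (fun p : (Fin r₂ → UnitAddCircle) × (Fin (r₁ + r₂ - 1) → ℝ) =>
        polarPoint hn b w ε p.1 p.2) ⁻¹' {h | freeLog hn (h : GL (Fin n) ℝ) ∈ D} =
        Set.univ ×ˢ D := by
      ext p
      simp [freeLog_polarPoint]
    rw [e, Measure.prod_prod, measure_univ, one_mul]
  simp [this]

end HaarModel

/-! ### Cyclic vectors of a matrix with irreducible characteristic polynomial -/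

section CyclicVector

/-- The matrix with columns `v, X v, …, X^{n-1} v`. -/
def krylov {n : ℕ} {F : Type*} [CommRing F] (X : Matrix (Fin n) (Fin n) F) (v : Fin n → F) :
    Matrix (Fin n) (Fin n) F :=
  Matrix.of fun i k => (X ^ (k : ℕ)).mulVec v i

theorem krylov_map {n : ℕ} {F E : Type*} [CommRing F] [CommRing E] (f : F →+* E)
    (X : Matrix (Fin n) (Fin n) F) (v : Fin n → F) :
    krylov (X.map f) (f ∘ v) = (krylov X v).map f := by
  ext i k
  simp only [krylov, Matrix.of_apply, Matrix.map_apply]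
  rw [← Matrix.map_pow, RingHom.map_mulVec]

theorem aeval_mulVec {n : ℕ} {F : Type*} [CommRing F] (X : Matrix (Fin n) (Fin n) F)
    (v c : Fin n → F) :
    (Polynomial.aeval X (∑ k : Fin n, Polynomial.C (c k) * Polynomial.X ^ (k : ℕ))).mulVec v =
      (krylov X v).mulVec c := by
  rw [map_sum, Matrix.sum_mulVec]
  funext i
  rw [Finset.sum_apply]
  refine Finset.sum_congr rfl fun k _ => ?_
  rw [map_mul, Polynomial.aeval_C, map_pow, Polynomial.aeval_X, ← Algebra.smul_def,
    Matrix.smul_mulVec, Pi.smul_apply, smul_eq_mul, mul_comm]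
  rfl

/-- A relation among the columns is a nonzero polynomial `q` of degree below `n` with `q(X) v = 0`.
It is coprime to the characteristic polynomial, so Bézout and Cayley–Hamilton give `v = 0`. -/
theorem det_krylov_ne_zero {n : ℕ} {F : Type*} [Field F] {X : Matrix (Fin n) (Fin n) F}
    (hX : Irreducible X.charpoly) {v : Fin n → F} (hv : v ≠ 0) : (krylov X v).det ≠ 0 := by
  intro h
  obtain ⟨c, hc, h0⟩ := Matrix.exists_mulVec_eq_zero_iff.2 h
  set q : Polynomial F := ∑ k : Fin n, Polynomial.C (c k) * Polynomial.X ^ (k : ℕ) with hq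
  have hq0 : q ≠ 0 := by
    obtain ⟨k, hk⟩ := Function.ne_iff.1 hc
    intro h
    apply hk
    have h1 := congrArg (fun p => Polynomial.coeff p (k : ℕ)) h
    simpa [hq, Polynomial.finsetSum_coeff, Polynomial.coeff_X_pow, Fin.val_inj] using h1
  have hdvd : ¬ X.charpoly ∣ q := by
    refine Polynomial.not_dvd_of_degree_lt hq0 ?_
    rw [Matrix.charpoly_degree_eq_dim, Fintype.card_fin]
    exact Polynomial.degree_sum_fin_lt c
  obtain ⟨a, b, hab⟩ := (hX.coprime_iff_not_dvd).2 hdvd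
  have h1 := congrArg (fun p => (Polynomial.aeval X p).mulVec v) hab
  simp only [map_add, map_mul, Matrix.aeval_self_charpoly, mul_zero, zero_add, map_one,
    Matrix.one_mulVec] at h1
  rw [← Matrix.mulVec_mulVec, hq, aeval_mulVec, h0, Matrix.mulVec_zero] at h1
  exact hv h1.symm

/-- A matrix that commutes with one whose characteristic polynomial is irreducible over a
subfield is a polynomial in it. -/
theorem exists_eq_aeval_of_commute {n : ℕ} {F E : Type*} [Field F] [Field E] (f : F →+* E)
    {X : Matrix (Fin n) (Fin n) F} (hX : Irreducible X.charpoly) {M : Matrix (Fin n) (Fin n) E}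
    (hM : Commute M (X.map f)) : ∃ p : Polynomial E, M = Polynomial.aeval (X.map f) p := by
  -- The cyclic vector is the first basis vector, so dimension zero is set apart. It is taken over
  -- `F`, because over `E` the characteristic polynomial may factor; the nonvanishing determinant
  -- survives the extension.
  rcases n with _ | n
  · exact ⟨0, Subsingleton.elim _ _⟩
  set v : Fin (n + 1) → F := Pi.single 0 1 with hv
  have hv0 : v ≠ 0 := by simp [hv]
  have hdet : (krylov (X.map f) (f ∘ v)).det ≠ 0 := by
    rw [krylov_map]
    change ((f.mapMatrix (krylov X v))).det ≠ 0
    rw [← RingHom.map_det, map_ne_zero]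
    exact det_krylov_ne_zero hX hv0
  have hu : IsUnit (krylov (X.map f) (f ∘ v)).det := isUnit_iff_ne_zero.2 hdet
  set c := (krylov (X.map f) (f ∘ v))⁻¹.mulVec (M.mulVec (f ∘ v)) with hc
  refine ⟨∑ k : Fin (n + 1), Polynomial.C (c k) * Polynomial.X ^ (k : ℕ), ?_⟩
  set p : Polynomial E := ∑ k : Fin (n + 1), Polynomial.C (c k) * Polynomial.X ^ (k : ℕ) with hp
  have h1 : (Polynomial.aeval (X.map f) p).mulVec (f ∘ v) = M.mulVec (f ∘ v) := by
    rw [hp, aeval_mulVec, hc, Matrix.mulVec_mulVec, Matrix.mul_nonsing_inv _ hu,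
      Matrix.one_mulVec]
  -- `M` and `p(X)` agree on the cyclic vector and both commute with `X`, so they agree on every
  -- column `X ^ k v`.
  have h2 : M * krylov (X.map f) (f ∘ v) =
      Polynomial.aeval (X.map f) p * krylov (X.map f) (f ∘ v) := by
    ext i k
    have h3 : ∀ N : Matrix (Fin (n + 1)) (Fin (n + 1)) E, Commute N (X.map f) →
        (N * krylov (X.map f) (f ∘ v)) i k =
          ((X.map f) ^ (k : ℕ)).mulVec (N.mulVec (f ∘ v)) i := by
      intro N hN
      rw [Matrix.mulVec_mulVec, ← (hN.pow_right (k : ℕ)).eq, ← Matrix.mulVec_mulVec]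
      rfl
    rw [h3 M hM, h3 _ (by
      simpa using (Commute.all p Polynomial.X).map (Polynomial.aeval (X.map f))),
      h1]
  have h4 := congrArg (· * (krylov (X.map f) (f ∘ v))⁻¹) h2
  simpa only [mul_assoc, Matrix.mul_nonsing_inv _ hu, mul_one] using h4

/-- If `v` is orthogonal to the eigenvector `ω`, so are all `(Xᵀ) ^ k v`, since the power moves
across to `ω` as the scalar `α ^ k`. For `v ≠ 0` these vectors span, which would force `ω = 0`. -/
theorem eq_zero_of_dotProduct_eq_zero {n : ℕ} {F E : Type*} [Field F] [Field E] (f : F →+* E)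
    {X : Matrix (Fin n) (Fin n) F} (hX : Irreducible X.charpoly) {ω : Fin n → E} {α : E}
    (hω0 : ω ≠ 0) (hω : (X.map f).mulVec ω = α • ω) {v : Fin n → F}
    (hv : (f ∘ v) ⬝ᵥ ω = 0) : v = 0 := by
  by_contra hv0
  have hdet := det_krylov_ne_zero (X := X.transpose) (by rwa [Matrix.charpoly_transpose]) hv0
  have hdet' : ((krylov X.transpose v).map f).transpose.det ≠ 0 := by
    rw [Matrix.det_transpose]
    change ((f.mapMatrix (krylov X.transpose v))).det ≠ 0
    rwa [← RingHom.map_det, map_ne_zero]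
  have hpow : ∀ k : ℕ, ((X.map f) ^ k).mulVec ω = α ^ k • ω := by
    intro k
    induction k with
    | zero => simp
    | succ k ih => rw [pow_succ, ← Matrix.mulVec_mulVec, hω, Matrix.mulVec_smul, ih, smul_smul,
        pow_succ']
  refine hω0 (Matrix.eq_zero_of_mulVec_eq_zero hdet' ?_)
  funext k
  have h1 : ((krylov X.transpose v).map f).transpose.mulVec ω k =
      (f ∘ v) ⬝ᵥ (((X.map f) ^ (k : ℕ)).mulVec ω) := by
    rw [Matrix.dotProduct_mulVec]
    rw [← krylov_map]
    simp only [Matrix.mulVec, Matrix.transpose_apply, krylov, Matrix.of_apply]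
    congr 1
    funext i
    rw [Matrix.transpose_map, ← Matrix.transpose_pow]
    change (((X.map f) ^ (k : ℕ)).transpose.mulVec (f ∘ v)) i = _
    rw [Matrix.mulVec_transpose]
  rw [h1, hpow, dotProduct_smul, hv]
  simp

end CyclicVector

open NumberField NumberField.Units

/-! ### Units of an order inside the units of the maximal order -/

section Order

set_option linter.unusedSectionVars false

variable {K : Type*} [Field K] [NumberField K] (O : Subring K)

/-- The inclusion of the units of an order into the units of the maximal order. -/
noncomputable def unitsInclusion (hO : ∀ x ∈ O, IsIntegral ℤ x) : Oˣ →* (𝓞 K)ˣ :=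
  Units.map (RingOfIntegers.restrict_monoidHom (O.subtype : O →* K) fun x => hO x x.2)

variable {O} (hO : ∀ x ∈ O, IsIntegral ℤ x)

theorem coe_unitsInclusion (u : Oˣ) : ((unitsInclusion O hO u : 𝓞 K) : K) = ((u : O) : K) :=
  rfl

theorem unitsInclusion_injective : Function.Injective (unitsInclusion O hO) := by
  intro u v h
  refine Units.ext (Subtype.ext ?_)
  rw [← coe_unitsInclusion hO, h, coe_unitsInclusion]

theorem unitsInclusion_mem_torsion_iff (u : Oˣ) :
    unitsInclusion O hO u ∈ torsion K ↔ u ∈ CommGroup.torsion Oˣ :=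
  (unitsInclusion_injective hO).isOfFinOrder_iff

theorem finite_torsion_units (hO : ∀ x ∈ O, IsIntegral ℤ x) : Finite (CommGroup.torsion Oˣ) := by
  refine Finite.of_injective (fun u : CommGroup.torsion Oˣ =>
    (⟨unitsInclusion O hO u, (unitsInclusion_mem_torsion_iff hO u).2 u.2⟩ : torsion K)) ?_
  intro u v h
  exact Subtype.ext (unitsInclusion_injective hO (congrArg Subtype.val h))

/-- Units congruent to `1` modulo `m` lie in `1 + m 𝓞 K ⊆ O`, as do their inverses. They form the
kernel of a homomorphism to the units of the finite ring `𝓞 K / m`. -/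
theorem finiteIndex_range_unitsInclusion {m : ℤ} (hm0 : m ≠ 0)
    (hm : ∀ x : 𝓞 K, (m : K) * x ∈ O) : (unitsInclusion O hO).range.FiniteIndex := by
  set I : Ideal (𝓞 K) := Ideal.span {(m : 𝓞 K)} with hI
  have hI0 : I ≠ ⊥ := by
    rw [hI, Ne, Ideal.span_singleton_eq_bot]
    exact_mod_cast hm0
  have : Finite (𝓞 K ⧸ I) := Ideal.finiteQuotientOfFreeOfNeBot I hI0
  have hfin : (Units.map (Ideal.Quotient.mk I : 𝓞 K →* 𝓞 K ⧸ I)).ker.FiniteIndex :=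
    Subgroup.finiteIndex_ker _
  have hmem : ∀ x : (𝓞 K)ˣ, x ∈ (Units.map (Ideal.Quotient.mk I : 𝓞 K →* 𝓞 K ⧸ I)).ker →
      ((x : 𝓞 K) : K) ∈ O := by
    intro x hx
    have h1 : Ideal.Quotient.mk I (x : 𝓞 K) = Ideal.Quotient.mk I 1 := by
      simpa using congrArg Units.val (MonoidHom.mem_ker.1 hx)
    rw [Ideal.Quotient.eq, hI, Ideal.mem_span_singleton] at h1
    obtain ⟨y, hy⟩ := h1
    have h2 : ((x : 𝓞 K) : K) = 1 + (m : K) * y := by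
      have := congrArg (fun z : 𝓞 K => (z : K)) (sub_eq_iff_eq_add'.1 hy)
      simpa using this
    rw [h2]
    exact add_mem (one_mem _) (hm y)
  refine Subgroup.finiteIndex_of_le
    (H := (Units.map (Ideal.Quotient.mk I : 𝓞 K →* 𝓞 K ⧸ I)).ker) fun x hx => ?_
  refine ⟨⟨⟨_, hmem x hx⟩, ⟨_, hmem x⁻¹ (inv_mem hx)⟩, ?_, ?_⟩, ?_⟩
  · refine Subtype.ext ?_
    change ((x : 𝓞 K) : K) * ((x⁻¹ : (𝓞 K)ˣ) : 𝓞 K) = 1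
    rw [← map_mul, Units.mul_inv, map_one]
  · refine Subtype.ext ?_
    change (((x⁻¹ : (𝓞 K)ˣ) : 𝓞 K) : K) * (x : 𝓞 K) = 1
    rw [← map_mul, Units.inv_mul, map_one]
  · exact Units.ext (RingOfIntegers.ext rfl)

/-- The logarithmic embedding of the units of the maximal order, onto the unit lattice. -/
noncomputable def toUnitLattice : Additive (𝓞 K)ˣ →+ unitLattice K :=
  (logEmbedding K).codRestrict (unitLattice K) fun x => ⟨x, trivial, rfl⟩

theorem toUnitLattice_surjective : Function.Surjective (toUnitLattice (K := K)) := by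
  rintro ⟨_, x, -, rfl⟩
  exact ⟨x, rfl⟩

instance free_unitLattice : Module.Free ℤ (unitLattice K) := by
  classical exact ZLattice.module_free ℝ _

instance finite_unitLattice : Module.Finite ℤ (unitLattice K) := by
  classical exact ZLattice.module_finite ℝ _

/-- The logarithmic embedding of the units of an order. -/
noncomputable def orderLog : Additive Oˣ →+ unitLattice K :=
  toUnitLattice.comp (MonoidHom.toAdditive (unitsInclusion O hO))

theorem orderLog_eq_zero_iff (u : Oˣ) :
    orderLog hO (Additive.ofMul u) = 0 ↔ u ∈ CommGroup.torsion Oˣ := by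
  rw [← unitsInclusion_mem_torsion_iff hO, ← dirichletUnitTheorem.logEmbedding_eq_zero_iff,
    Subtype.ext_iff]
  rfl

/-- The logarithmic image has finite index in the unit lattice, because the index of an image under
a surjection divides the original index; hence it has full rank. -/
theorem finrank_range_orderLog (hfin : (unitsInclusion O hO).range.FiniteIndex) :
    Module.finrank ℤ (orderLog hO).toIntLinearMap.range = rank K := by
  rw [← unitLattice_rank, ← Submodule.finiteQuotient_iff]
  have h1 : (orderLog hO).range.index ≠ 0 := by
    rw [orderLog, AddMonoidHom.range_comp]
    refine ne_zero_of_dvd_ne_zero ?_ (AddSubgroup.index_map_dvd _ toUnitLattice_surjective)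
    exact hfin.index_ne_zero
  rw [AddSubgroup.index_ne_zero_iff_finite] at h1
  exact h1

/-- Lift a ℤ-basis of the logarithmic image. The basis coordinates determine the exponents, and the
remaining factor is torsion since torsion is the kernel. -/
theorem exists_isFundamentalSystem (hfin : (unitsInclusion O hO).range.FiniteIndex) {m : ℕ}
    (hm : rank K = m) : ∃ ε : Fin m → Oˣ, IsFundamentalSystem O ε := by
  set N := (orderLog hO).toIntLinearMap.range with hN
  have hrank : Module.finrank ℤ N = m := (finrank_range_orderLog hO hfin).trans hm
  let bN : Module.Basis (Fin m) ℤ N := Module.finBasisOfFinrankEq ℤ N hrank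
  have hlift : ∀ i, ∃ u : Oˣ, orderLog hO (Additive.ofMul u) = bN i := fun i => by
    obtain ⟨u, hu⟩ := (bN i).2
    exact ⟨u.toMul, hu⟩
  choose ε hε using hlift
  have hφ : ∀ (ζ : CommGroup.torsion Oˣ) (k : Fin m → ℤ),
      orderLog hO (Additive.ofMul ((ζ : Oˣ) * ∏ j, ε j ^ k j)) =
        ((∑ j, k j • bN j : N) : unitLattice K) := by
    intro ζ k
    rw [ofMul_mul, map_add, (orderLog_eq_zero_iff hO _).2 ζ.2, zero_add, ofMul_prod,
      map_sum]
    simp only [ofMul_zpow, map_zsmul, hε]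
    push_cast
    rfl
  refine ⟨ε, fun u => ?_⟩
  set x : N := ⟨orderLog hO (Additive.ofMul u), ⟨Additive.ofMul u, rfl⟩⟩ with hx
  have hmem : u * (∏ j, ε j ^ bN.repr x j)⁻¹ ∈ CommGroup.torsion Oˣ := by
    rw [← orderLog_eq_zero_iff hO, ofMul_mul, map_add, ofMul_inv, map_neg,
      add_neg_eq_zero]
    have h1 := hφ 1 (bN.repr x)
    rw [OneMemClass.coe_one, one_mul, bN.sum_repr] at h1
    exact h1.symm
  refine ⟨(⟨_, hmem⟩, bN.repr x), by simp, ?_⟩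
  rintro ⟨ζ, k⟩ h
  have h1 : ∑ j, k j • bN j = x := by
    refine Subtype.ext ?_
    rw [← hφ ζ k, ← h]
  have h2 : k = bN.repr x := by
    funext j
    rw [← h1, bN.repr_sum_self]
  subst h2
  refine Prod.ext (Subtype.ext ?_) rfl
  exact eq_mul_inv_of_mul_eq h.symm

theorem closure_sup_torsion_eq {m : ℕ} {ε : Fin m → Oˣ} (hε : IsFundamentalSystem O ε)
    {ι : Type*} (e : ι ≃ Fin m) :
    Subgroup.closure (Set.range fun i => unitsInclusion O hO (ε (e i))) ⊔ torsion K =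
      (unitsInclusion O hO).range ⊔ torsion K := by
  refine le_antisymm (sup_le_sup_right ?_ _) (sup_le ?_ le_sup_right)
  · rw [Subgroup.closure_le]
    rintro _ ⟨i, rfl⟩
    exact ⟨_, rfl⟩
  · rintro _ ⟨u, rfl⟩
    obtain ⟨⟨ζ, k⟩, h, -⟩ := hε u
    rw [h, map_mul, map_prod]
    refine mul_mem (Subgroup.mem_sup_right ((unitsInclusion_mem_torsion_iff hO _).2 ζ.2))
      (Subgroup.mem_sup_left (prod_mem fun j _ => ?_))
    rw [map_zpow]
    exact zpow_mem (Subgroup.subset_closure (Set.mem_range.2 ⟨e.symm j, by simp⟩)) _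

end Order

/-! ### Numbered embeddings, infinite places and the regulator -/

section Numbering

variable {K : Type*} [Field K] {r₁ r₂ : ℕ} (σ : EmbeddingNumbering K r₁ r₂)

/-- The infinite places in the order given by a numbering of the embeddings. -/
noncomputable def placeOf : Fin (r₁ + r₂) → InfinitePlace K :=
  Fin.addCases (fun i => InfinitePlace.mk (Complex.ofRealHom.comp (σ.real i)))
    (fun j => InfinitePlace.mk (σ.cplx j))

theorem conj_real (i : Fin r₁) :
    ComplexEmbedding.conjugate (Complex.ofRealHom.comp (σ.real i)) =
      Complex.ofRealHom.comp (σ.real i) := by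
  ext x
  simp [ComplexEmbedding.conjugate_coe_eq]

/-- Two embeddings define the same place exactly when they are equal or conjugate, and the numbering
lists one embedding from each conjugate pair. -/
theorem placeOf_bijective : Function.Bijective (placeOf σ) := by
  have hinj := σ.bijective.1
  constructor
  · have key : ∀ i j, (InfinitePlace.mk (Complex.ofRealHom.comp (σ.real i)) ≠
        InfinitePlace.mk (σ.cplx j)) := by
      intro i j h
      rcases InfinitePlace.mk_eq_iff.1 h with h | h
      · simpa using @hinj (Sum.inl i) (Sum.inr (Sum.inl j)) h
      · rw [conj_real] at h
        simpa using @hinj (Sum.inl i) (Sum.inr (Sum.inl j)) h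
    intro i j
    refine Fin.addCases (fun i => ?_) (fun i => ?_) i <;>
    refine Fin.addCases (fun j => ?_) (fun j => ?_) j <;> intro h <;>
    simp only [placeOf, Fin.addCases_left, Fin.addCases_right] at h
    · rw [InfinitePlace.mk_eq_iff, conj_real, or_self] at h
      have := @hinj (Sum.inl i) (Sum.inl j) h
      simp_all
    · exact absurd h (key _ _)
    · exact absurd h.symm (key _ _)
    · rcases InfinitePlace.mk_eq_iff.1 h with h | h
      · have := @hinj (Sum.inr (Sum.inl i)) (Sum.inr (Sum.inl j)) h
        simp_all
      · have := @hinj (Sum.inr (Sum.inr i)) (Sum.inr (Sum.inl j)) h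
        simp at this
  · intro v
    obtain ⟨s, hs⟩ := σ.bijective.2 v.embedding
    rcases s with i | j | j
    · exact ⟨Fin.castAdd r₂ i, by
        rw [placeOf, Fin.addCases_left, ← InfinitePlace.mk_embedding v, ← hs]
        rfl⟩
    · exact ⟨Fin.natAdd r₁ j, by
        rw [placeOf, Fin.addCases_right, ← InfinitePlace.mk_embedding v, ← hs]
        rfl⟩
    · exact ⟨Fin.natAdd r₁ j, by
        rw [placeOf, Fin.addCases_right, ← InfinitePlace.mk_embedding v, ← hs,
          ← InfinitePlace.mk_conjugate_eq]
        rfl⟩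

/-- The weights `ν_i` are the multiplicities of the places. An embedding in `cplx` is not real,
since otherwise it would equal its conjugate and the numbering would list it twice. -/
theorem logCoord_eq (x : K) (i : Fin (r₁ + r₂)) :
    logCoord σ x i = (placeOf σ i).mult * Real.log (placeOf σ i x) := by
  have hinj := σ.bijective.1
  refine Fin.addCases (fun i => ?_) (fun j => ?_) i
  · simp only [logCoord, placeOf, Fin.addCases_left]
    have h : (InfinitePlace.mk (Complex.ofRealHom.comp (σ.real i))).IsReal :=
      ⟨_, ComplexEmbedding.isReal_iff.2 (conj_real σ i), rfl⟩
    rw [InfinitePlace.mult_isReal ⟨_, h⟩, InfinitePlace.apply]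
    simp
  · simp only [logCoord, placeOf, Fin.addCases_right]
    have h : (InfinitePlace.mk (σ.cplx j)).IsComplex := by
      refine ⟨_, fun h => ?_, rfl⟩
      have := @hinj (Sum.inr (Sum.inr j)) (Sum.inr (Sum.inl j)) (ComplexEmbedding.isReal_iff.1 h)
      simp at this
    rw [InfinitePlace.mult_isComplex ⟨_, h⟩, InfinitePlace.apply]
    simp

variable [NumberField K]

theorem card_places (σ : EmbeddingNumbering K r₁ r₂) : Fintype.card (InfinitePlace K) = r₁ + r₂ := by
  rw [← Fintype.card_congr (Equiv.ofBijective _ (placeOf_bijective σ)), Fintype.card_fin]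

theorem pos_of_numbering (σ : EmbeddingNumbering K r₁ r₂) : 0 < r₁ + r₂ := by
  rw [← card_places σ]
  exact Fintype.card_pos

theorem rank_eq (σ : EmbeddingNumbering K r₁ r₂) : rank K = r₁ + r₂ - 1 := by
  rw [rank, card_places σ]

theorem regulatorOf_eq {O : Subring K} (hO : ∀ x ∈ O, IsIntegral ℤ x)
    (ε : Fin (r₁ + r₂ - 1) → Oˣ) :
    regulatorOf σ ε =
      regOfFamily fun i => unitsInclusion O hO (ε (finCongr (rank_eq σ) i)) := by
  classical
  have hpos := pos_of_numbering σ
  have hinj := (placeOf_bijective σ).1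
  -- `regulatorOf` omits the last place, while `regOfFamily` may be computed with any place omitted.
  set last : Fin (r₁ + r₂) := ⟨r₁ + r₂ - 1, by omega⟩ with hlast
  let f : Fin (r₁ + r₂ - 1) → {v : InfinitePlace K // v ≠ placeOf σ last} := fun i =>
    ⟨placeOf σ (Fin.castLE (Nat.sub_le _ _) i), fun h => by
      have := congrArg Fin.val (hinj h)
      simp only [Fin.val_castLE, hlast] at this
      omega⟩
  have hf : Function.Bijective f := by
    constructor
    · intro i j h
      exact Fin.castLE_injective _ (hinj (congrArg Subtype.val h))
    · rintro ⟨v, hv⟩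
      obtain ⟨i, rfl⟩ := (placeOf_bijective σ).2 v
      have : (i : ℕ) < r₁ + r₂ - 1 := by
        have h1 : i ≠ last := fun h => hv (by rw [h])
        have h2 : (i : ℕ) ≠ r₁ + r₂ - 1 := fun h => h1 (Fin.ext h)
        omega
      exact ⟨⟨i, this⟩, rfl⟩
  let F := Equiv.ofBijective f hf
  rw [regOfFamily_eq_det _ (placeOf σ last) (F.symm.trans (finCongr (rank_eq σ)).symm),
    regulatorOf, ← Matrix.det_transpose, ← Matrix.det_submatrix_equiv_self F]
  congr 2
  ext i j
  simp only [Matrix.transpose_apply, Matrix.of_apply, Matrix.submatrix_apply, Equiv.trans_apply,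
    Equiv.symm_apply_apply, Equiv.apply_symm_apply, coe_unitsInclusion]
  rw [logCoord_eq]
  rfl

/-- The regulator of an order in terms of the regulator of the field. -/
noncomputable def orderRegulator {O : Subring K} (hO : ∀ x ∈ O, IsIntegral ℤ x) : ℝ :=
  regulator K * ((unitsInclusion O hO).range ⊔ torsion K).index

/-- The right side does not involve `ε`: together with the roots of unity of `K`, any fundamental
system generates `Oˣ · μ_K`, whose index is the ratio of regulators. -/
theorem regulatorOf_eq_orderRegulator {O : Subring K} (hO : ∀ x ∈ O, IsIntegral ℤ x)
    {ε : Fin (r₁ + r₂ - 1) → Oˣ} (hε : IsFundamentalSystem O ε) :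
    regulatorOf σ ε = orderRegulator hO := by
  rw [regulatorOf_eq σ hO, orderRegulator,
    ← closure_sup_torsion_eq hO hε (finCongr (rank_eq σ)), ← regOfFamily_div_regulator,
    mul_div_cancel₀ _ (regulator_ne_zero K)]

theorem orderRegulator_ne_zero {O : Subring K} (hO : ∀ x ∈ O, IsIntegral ℤ x)
    (hfin : (unitsInclusion O hO).range.FiniteIndex) : orderRegulator hO ≠ 0 := by
  have := (finiteIndex_iff_sup_torsion_finiteIndex _).1 hfin
  exact mul_ne_zero (regulator_ne_zero K) (Nat.cast_ne_zero.2 this.index_ne_zero)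

theorem isRegulator_orderRegulator {O : Subring K} (hO : ∀ x ∈ O, IsIntegral ℤ x)
    (hfin : (unitsInclusion O hO).range.FiniteIndex) : IsRegulator σ O (orderRegulator hO) :=
  ⟨exists_isFundamentalSystem hO hfin (rank_eq σ),
    fun _ hε => regulatorOf_eq_orderRegulator σ hO hε⟩

end Numbering

/-! ### Block matrices as a copy of the algebra `ℝ^r₁ × ℂ^r₂` -/

section BlockAlgebra

variable {n r₁ r₂ : ℕ} (hn : r₁ + r₂ * 2 = n)

theorem blockMatrix_injective {a a' : Fin r₁ → ℝ} {z z' : Fin r₂ → ℂ}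
    (h : blockMatrix hn a z = blockMatrix hn a' z') : a = a' ∧ z = z' := by
  have h1 := (Matrix.reindex (blockIndex hn) (blockIndex hn)).injective h
  constructor
  · funext i
    simpa using congrFun (congrFun h1 (Sum.inl i)) (Sum.inl i)
  · funext j
    refine Complex.ext ?_ ?_
    · simpa [Matrix.blockDiagonal_apply] using
        congrFun (congrFun h1 (Sum.inr (0, j))) (Sum.inr (0, j))
    · simpa [Matrix.blockDiagonal_apply] using
        congrFun (congrFun h1 (Sum.inr (1, j))) (Sum.inr (0, j))

theorem blockMatrix_add (a a' : Fin r₁ → ℝ) (z z' : Fin r₂ → ℂ) :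
    blockMatrix hn (a + a') (z + z') = blockMatrix hn a z + blockMatrix hn a' z' := by
  ext s t
  obtain ⟨s, rfl⟩ := (blockIndex hn).surjective s
  obtain ⟨t, rfl⟩ := (blockIndex hn).surjective t
  rcases s with s | ⟨s, s'⟩ <;> rcases t with t | ⟨t, t'⟩
  · by_cases h : s = t <;> simp [blockMatrix, h]
  · simp [blockMatrix]
  · simp [blockMatrix]
  · fin_cases s <;> fin_cases t <;> by_cases h : s' = t' <;>
      simp [blockMatrix, Matrix.blockDiagonal_apply, h, add_comm]

theorem blockMatrix_const (c : ℝ) :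
    blockMatrix hn (fun _ : Fin r₁ => c) (fun _ : Fin r₂ => (c : ℂ)) =
      algebraMap ℝ (Matrix (Fin n) (Fin n) ℝ) c := by
  ext s t
  obtain ⟨s, rfl⟩ := (blockIndex hn).surjective s
  obtain ⟨t, rfl⟩ := (blockIndex hn).surjective t
  rw [Matrix.algebraMap_matrix_apply]
  rcases s with s | ⟨s, s'⟩ <;> rcases t with t | ⟨t, t'⟩
  · by_cases h : s = t <;> simp [blockMatrix, h]
  · simp [blockMatrix]
  · simp [blockMatrix]
  · fin_cases s <;> fin_cases t <;> by_cases h : s' = t' <;>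
      simp [blockMatrix, Matrix.blockDiagonal_apply, h]

theorem aeval_blockMatrix (b : Fin r₁ → ℝ) (w : Fin r₂ → ℂ) (p : Polynomial ℝ) :
    Polynomial.aeval (blockMatrix hn b w) p =
      blockMatrix hn (fun i => Polynomial.aeval (b i) p) (fun j => Polynomial.aeval (w j) p) := by
  induction p using Polynomial.induction_on' with
  | add p q hp hq =>
    rw [map_add, hp, hq, ← blockMatrix_add]
    congr 1 <;> funext i <;> simp
  | monomial k c =>
    rw [Polynomial.aeval_monomial]
    have hpow : blockMatrix hn b w ^ k = blockMatrix hn (b ^ k) (w ^ k) := by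
      induction k with
      | zero => simp [blockMatrix_one]
      | succ k ih => rw [pow_succ, ih, blockMatrix_mul, ← pow_succ, ← pow_succ]
    rw [hpow, ← blockMatrix_const hn, blockMatrix_mul]
    congr 1 <;> funext i <;> simp [Polynomial.aeval_monomial]

end BlockAlgebra

/-! ### The eigenvector lattice and its order -/

section Lattice

set_option linter.unusedSectionVars false

variable {K : Type*} [Field K] [NumberField K] {n : ℕ} {X : Matrix (Fin n) (Fin n) ℚ} {ω : Fin n → K}
  {α : K}

theorem linearIndependent_eigenvector (hX : Irreducible X.charpoly) (hω0 : ω ≠ 0)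
    (hω : (X.map (algebraMap ℚ K)).mulVec ω = α • ω) : LinearIndependent ℚ ω := by
  rw [Fintype.linearIndependent_iff]
  intro g hg
  refine congrFun (eq_zero_of_dotProduct_eq_zero (algebraMap ℚ K) hX hω0 hω ?_)
  rw [← hg]
  refine Finset.sum_congr rfl fun i _ => ?_
  rw [Algebra.smul_def]
  rfl

theorem eq_of_mulVec_eq (hX : Irreducible X.charpoly) (hω0 : ω ≠ 0)
    (hω : (X.map (algebraMap ℚ K)).mulVec ω = α • ω) {A B : Matrix (Fin n) (Fin n) ℚ}
    (h : (A.map (algebraMap ℚ K)).mulVec ω = (B.map (algebraMap ℚ K)).mulVec ω) : A = B := by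
  ext i j
  have h1 := linearIndependent_eigenvector hX hω0 hω
  rw [Fintype.linearIndependent_iff] at h1
  refine sub_eq_zero.1 (h1 (fun j => A i j - B i j) ?_ j)
  have h2 := congrFun h i
  simp only [Matrix.mulVec, dotProduct, Matrix.map_apply] at h2
  simp only [Algebra.smul_def, map_sub, sub_mul, Finset.sum_sub_distrib, h2, sub_self]

theorem mem_orderOfLattice_iff {ω : Fin n → K} {β : K} :
    β ∈ orderOfLattice (Submodule.span ℤ (Set.range ω)) ↔
      ∃ A : Matrix (Fin n) (Fin n) ℤ, (A.map (Int.cast : ℤ → K)).mulVec ω = β • ω := by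
  constructor
  · intro h
    have h1 : ∀ i, ∃ c : Fin n → ℤ, ∑ j, c j • ω j = β * ω i := fun i =>
      (Submodule.mem_span_range_iff_exists_fun ℤ).1 (h _ (Submodule.subset_span ⟨i, rfl⟩))
    choose A hA using h1
    refine ⟨Matrix.of A, funext fun i => ?_⟩
    rw [Pi.smul_apply, smul_eq_mul, ← hA]
    simp only [Matrix.mulVec, dotProduct, Matrix.map_apply, Matrix.of_apply, zsmul_eq_mul]
  · rintro ⟨A, hA⟩ x hx
    induction hx using Submodule.span_induction with
    | mem x hx =>
      obtain ⟨i, rfl⟩ := hx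
      have h1 := congrFun hA i
      rw [Pi.smul_apply, smul_eq_mul] at h1
      rw [← h1]
      simp only [Matrix.mulVec, dotProduct, Matrix.map_apply, ← zsmul_eq_mul]
      refine Submodule.sum_mem _ fun j _ => ?_
      exact Submodule.smul_mem _ _ (Submodule.subset_span ⟨j, rfl⟩)
    | zero => simp
    | add x y _ _ hx hy =>
      rw [mul_add]
      exact add_mem hx hy
    | smul c x _ hx =>
      rw [mul_smul_comm]
      exact Submodule.smul_mem _ _ hx

/-- Such an element stabilizes a nonzero finitely generated ℤ-submodule of a field. -/
theorem isIntegral_of_mem_orderOfLattice {ω : Fin n → K} (hω0 : ω ≠ 0) :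
    ∀ x ∈ orderOfLattice (Submodule.span ℤ (Set.range ω)), IsIntegral ℤ x := by
  intro x hx
  refine isIntegral_of_smul_mem_submodule (M := K) (Submodule.span ℤ (Set.range ω)) ?_
    (Submodule.fg_span (Set.finite_range ω)) x hx
  obtain ⟨i, hi⟩ := Function.ne_iff.1 hω0
  exact (Submodule.ne_bot_iff _).2 ⟨ω i, Submodule.subset_span ⟨i, rfl⟩, hi⟩

-- A common denominator `m` for the matrices, in the basis `bω`, of multiplication by an integral
-- basis of `𝓞 K` makes all of them integral.
open NumberField in
theorem exists_int_mul_mem_orderOfLattice (bω : Module.Basis (Fin n) ℚ K) :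
    ∃ m : ℤ, m ≠ 0 ∧ ∀ x : 𝓞 K, (m : K) * x ∈ orderOfLattice (Submodule.span ℤ (Set.range bω)) := by
  let B := RingOfIntegers.basis K
  obtain ⟨m, hm⟩ := IsLocalization.exist_integer_multiples_of_finite (nonZeroDivisors ℤ)
    (fun p : Module.Free.ChooseBasisIndex ℤ (𝓞 K) × Fin n × Fin n =>
      bω.repr ((B p.1 : K) * bω p.2.1) p.2.2)
  refine ⟨m, nonZeroDivisors.coe_ne_zero m, fun x => ?_⟩
  have h1 : ∀ k, ((m : ℤ) : K) * (B k : 𝓞 K) ∈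
      orderOfLattice (Submodule.span ℤ (Set.range bω)) := by
    intro k
    choose c hc using fun i j => hm (k, i, j)
    refine mem_orderOfLattice_iff.2 ⟨Matrix.of c, funext fun i => ?_⟩
    rw [Pi.smul_apply, smul_eq_mul, mul_assoc]
    conv_rhs => rw [← bω.sum_repr ((B k : K) * bω i), Finset.mul_sum]
    simp only [Matrix.mulVec, dotProduct]
    refine Finset.sum_congr rfl fun j _ => ?_
    rw [Matrix.map_apply, Matrix.of_apply, Algebra.smul_def, ← mul_assoc]
    congr 1
    have h2 := congrArg (algebraMap ℚ K) (hc i j)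
    rw [zsmul_eq_mul, map_mul, map_intCast] at h2
    rw [← h2]
    simp
  have h2 := congrArg (algebraMap (𝓞 K) K) (B.sum_repr x)
  rw [map_sum] at h2
  change ((m : ℤ) : K) * algebraMap (𝓞 K) K x ∈ _
  rw [← h2, Finset.mul_sum]
  refine sum_mem fun k _ => ?_
  rw [map_zsmul, mul_smul_comm]
  exact zsmul_mem (h1 k) _

theorem finiteIndex_units_orderOfLattice {ω : Fin n → K} (hli : LinearIndependent ℚ ω)
    (hcard : Module.finrank ℚ K = n) (hω0 : ω ≠ 0) :
    (unitsInclusion _ (isIntegral_of_mem_orderOfLattice hω0)).range.FiniteIndex := by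
  rcases n with _ | n
  · exact absurd (Subsingleton.elim _ _) hω0
  let bω := basisOfLinearIndependentOfCardEqFinrank hli (by rw [Fintype.card_fin, hcard])
  obtain ⟨m, hm0, hm⟩ := exists_int_mul_mem_orderOfLattice bω
  rw [coe_basisOfLinearIndependentOfCardEqFinrank] at hm
  exact finiteIndex_range_unitsInclusion _ hm0 hm

end Lattice

/-! ### Lattice points of the centralizer correspond to units of the order -/

section Correspondence

theorem conj_aeval {R A : Type*} [CommRing R] [Ring A] [Algebra R A] (g : Aˣ) (x : A)
    (p : Polynomial R) : (g : A) * Polynomial.aeval x p * (g⁻¹ : Aˣ) =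
      Polynomial.aeval ((g : A) * x * (g⁻¹ : Aˣ)) p := by
  induction p using Polynomial.induction_on' with
  | add p q hp hq => rw [map_add, map_add, mul_add, add_mul, hp, hq]
  | monomial k c =>
    rw [Polynomial.aeval_monomial, Polynomial.aeval_monomial, Units.conj_pow, ← mul_assoc,
      ← Algebra.commutes c (g : A)]
    simp only [mul_assoc]

theorem map_aeval_matrix {n : ℕ} {F E : Type*} [Field F] [Field E] [Algebra F E]
    (X : Matrix (Fin n) (Fin n) F) (p : Polynomial F) :
    (Polynomial.aeval X p).map (algebraMap F E) =
      Polynomial.aeval (X.map (algebraMap F E)) p :=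
  (Polynomial.aeval_algHom_apply (Algebra.ofId F E).mapMatrix X p).symm

theorem aeval_mulVec_of_eigenvector {n : ℕ} {F E : Type*} [Field F] [Field E] [Algebra F E]
    {X : Matrix (Fin n) (Fin n) E} {ω : Fin n → E} {α : E} (hω : X.mulVec ω = α • ω)
    (p : Polynomial F) : (Polynomial.aeval X p).mulVec ω = Polynomial.aeval α p • ω := by
  have hpow : ∀ k : ℕ, (X ^ k).mulVec ω = α ^ k • ω := by
    intro k
    induction k with
    | zero => simp
    | succ k ih => rw [pow_succ, ← Matrix.mulVec_mulVec, hω, Matrix.mulVec_smul, ih, smul_smul,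
        pow_succ']
  induction p using Polynomial.induction_on' with
  | add p q hp hq => rw [map_add, map_add, Matrix.add_mulVec, hp, hq, add_smul]
  | monomial k c =>
    rw [Polynomial.aeval_monomial, Polynomial.aeval_monomial, ← Algebra.smul_def,
      ← Algebra.smul_def, Matrix.smul_mulVec, hpow, smul_assoc]

theorem map_intCast_eq {n : ℕ} {E : Type*} [Field E] [CharZero E] [Algebra ℚ E]
    (A : Matrix (Fin n) (Fin n) ℤ) :
    A.map (Int.cast : ℤ → E) = (A.map (Int.cast : ℤ → ℚ)).map (algebraMap ℚ E) := by
  ext i j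
  simp

variable {K : Type*} [Field K] [NumberField K] {n r₁ r₂ : ℕ} (hn : r₁ + r₂ * 2 = n)
  (σ : EmbeddingNumbering K r₁ r₂) {α : K}

/-- Conjugated back by `g₀`, the element commutes with a rational matrix whose characteristic
polynomial is irreducible over `ℚ`, so it is a real polynomial in that matrix; the same polynomial
in the block matrix is block diagonal. -/
theorem exists_eq_blockMatrix_of_mem_torus {X : Matrix (Fin n) (Fin n) ℚ}
    (hX : Irreducible X.charpoly) {b : Fin r₁ → ℝ} {w : Fin r₂ → ℂ} {g₀ : GL (Fin n) ℝ}
    (hg : (g₀ : Matrix (Fin n) (Fin n) ℝ) * X.map (algebraMap ℚ ℝ) *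
      ((g₀⁻¹ : GL (Fin n) ℝ) : Matrix (Fin n) (Fin n) ℝ) = blockMatrix hn b w)
    (h : torus (blockMatrix hn b w)) :
    ∃ a z, ((h : GL (Fin n) ℝ) : Matrix (Fin n) (Fin n) ℝ) = blockMatrix hn a z := by
  set M : Matrix (Fin n) (Fin n) ℝ := ((h : GL (Fin n) ℝ) : Matrix (Fin n) (Fin n) ℝ) with hM
  have h1 : M * blockMatrix hn b w = blockMatrix hn b w * M := by
    rw [← Units.mul_inv_eq_iff_eq_mul]
    exact h.2.2
  have h2 : Commute (((g₀⁻¹ : GL (Fin n) ℝ) : Matrix (Fin n) (Fin n) ℝ) * M *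
      (g₀ : Matrix (Fin n) (Fin n) ℝ)) (X.map (algebraMap ℚ ℝ)) := by
    have hX' : X.map (algebraMap ℚ ℝ) = ((g₀⁻¹ : GL (Fin n) ℝ) : Matrix (Fin n) (Fin n) ℝ) *
        blockMatrix hn b w * (g₀ : Matrix (Fin n) (Fin n) ℝ) := by
      rw [← hg]
      simp [mul_assoc]
    rw [hX', commute_iff_eq]
    simp only [mul_assoc, Units.mul_inv_cancel_left]
    rw [← mul_assoc M, ← mul_assoc (blockMatrix hn b w), h1]
  obtain ⟨p, hp⟩ := exists_eq_aeval_of_commute (algebraMap ℚ ℝ) hX h2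
  have h3 : M = (g₀ : Matrix (Fin n) (Fin n) ℝ) *
      Polynomial.aeval (X.map (algebraMap ℚ ℝ)) p *
        ((g₀⁻¹ : GL (Fin n) ℝ) : Matrix (Fin n) (Fin n) ℝ) := by
    rw [← hp]
    simp [mul_assoc]
  rw [conj_aeval, hg, aeval_blockMatrix] at h3
  exact ⟨_, _, h3⟩

/-- Multiplication by `u`, on the basis `ω` and in the model. -/
theorem conj_eq_blockMatrix_of_mulVec_eq (hK : IntermediateField.adjoin ℚ {α} = ⊤)
    {X : Matrix (Fin n) (Fin n) ℚ} (hX : Irreducible X.charpoly)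
    {ω : Fin n → K} (hω0 : ω ≠ 0) (hω : (X.map (algebraMap ℚ K)).mulVec ω = α • ω)
    {g₀ : GL (Fin n) ℝ} (hg : (g₀ : Matrix (Fin n) (Fin n) ℝ) * X.map (algebraMap ℚ ℝ) *
      ((g₀⁻¹ : GL (Fin n) ℝ) : Matrix (Fin n) (Fin n) ℝ) = modelMatrix hn σ α)
    {A : Matrix (Fin n) (Fin n) ℚ} {u : K}
    (hA : (A.map (algebraMap ℚ K)).mulVec ω = u • ω) :
    (g₀ : Matrix (Fin n) (Fin n) ℝ) * A.map (algebraMap ℚ ℝ) *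
      ((g₀⁻¹ : GL (Fin n) ℝ) : Matrix (Fin n) (Fin n) ℝ) =
        blockMatrix hn (fun i => σ.real i u) (fun j => σ.cplx j u) := by
  have hu : u ∈ Algebra.adjoin ℚ {α} := by
    rw [← IntermediateField.adjoin_simple_toSubalgebra_of_isAlgebraic
      (Algebra.IsAlgebraic.isAlgebraic α), hK]
    trivial
  rw [Algebra.adjoin_singleton_eq_range_aeval] at hu
  obtain ⟨p, rfl⟩ := hu
  have hp : A = Polynomial.aeval X p := by
    refine eq_of_mulVec_eq hX hω0 hω (hA.trans ?_)
    rw [map_aeval_matrix]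
    exact (aeval_mulVec_of_eigenvector hω p).symm
  rw [hp, map_aeval_matrix, ← Polynomial.aeval_map_algebraMap ℝ, conj_aeval, hg, modelMatrix,
    aeval_blockMatrix]
  congr 1
  · funext i
    rw [Polynomial.aeval_map_algebraMap]
    exact Polynomial.aeval_algHom_apply (σ.real i).toRatAlgHom α p
  · funext j
    rw [Polynomial.aeval_map_algebraMap]
    exact Polynomial.aeval_algHom_apply (σ.cplx j).toRatAlgHom α p

variable {X₀ : Matrix (Fin n) (Fin n) ℤ} {ω : Fin n → K} {g₀ : GL (Fin n) ℝ}

theorem exists_lattice_point_of_unit (hK : IntermediateField.adjoin ℚ {α} = ⊤)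
    (hX : Irreducible (X₀.map (Int.cast : ℤ → ℚ)).charpoly) (hω0 : ω ≠ 0)
    (hω : (X₀.map (Int.cast : ℤ → K)).mulVec ω = α • ω)
    (hg : (g₀ : Matrix (Fin n) (Fin n) ℝ) * X₀.map (Int.cast : ℤ → ℝ) *
      ((g₀⁻¹ : GL (Fin n) ℝ) : Matrix (Fin n) (Fin n) ℝ) = modelMatrix hn σ α)
    (u : (orderOfLattice (Submodule.span ℤ (Set.range ω)))ˣ) :
    ∃ l : ((glInt n).map (MulAut.conj g₀).toMonoidHom).subgroupOf (torus (modelMatrix hn σ α)),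
      (((l : torus (modelMatrix hn σ α)) : GL (Fin n) ℝ) : Matrix (Fin n) (Fin n) ℝ) =
        blockMatrix hn (fun i => σ.real i ((u : orderOfLattice (Submodule.span ℤ (Set.range ω))) : K))
          (fun j => σ.cplx j ((u : orderOfLattice (Submodule.span ℤ (Set.range ω))) : K)) := by
  rw [map_intCast_eq] at hg hω
  obtain ⟨A, hA⟩ := mem_orderOfLattice_iff.1
    (u : orderOfLattice (Submodule.span ℤ (Set.range ω))).2
  obtain ⟨B, hB⟩ := mem_orderOfLattice_iff.1 ((u⁻¹ : (orderOfLattice (Submodule.span ℤ (Set.range ω)))ˣ) :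
    orderOfLattice (Submodule.span ℤ (Set.range ω))).2
  have hinj : Function.Injective fun A : Matrix (Fin n) (Fin n) ℤ => A.map (Int.cast : ℤ → ℚ) :=
    Matrix.map_injective Int.cast_injective
  -- Inverse field elements give inverse matrices, because a rational matrix is determined by its
  -- action on `ω`.
  have hone : ∀ (A B : Matrix (Fin n) (Fin n) ℤ) (x y : K),
      (A.map (Int.cast : ℤ → K)).mulVec ω = x • ω →
      (B.map (Int.cast : ℤ → K)).mulVec ω = y • ω → x * y = 1 → A * B = 1 := by
    intro A B x y hA hB hxy
    refine hinj (eq_of_mulVec_eq hX hω0 hω ?_)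
    change (((A * B).map (Int.cast : ℤ → ℚ)).map (algebraMap ℚ K)).mulVec ω =
      (((1 : Matrix (Fin n) (Fin n) ℤ).map (Int.cast : ℤ → ℚ)).map (algebraMap ℚ K)).mulVec ω
    rw [← map_intCast_eq, ← map_intCast_eq]
    have h1 : (A * B).map (Int.cast : ℤ → K) = A.map Int.cast * B.map Int.cast :=
      Matrix.map_mul (f := Int.castRingHom K)
    have h2 : (1 : Matrix (Fin n) (Fin n) ℤ).map (Int.cast : ℤ → K) = 1 :=
      Matrix.map_one _ Int.cast_zero Int.cast_one
    rw [h1, h2, ← Matrix.mulVec_mulVec, hB, Matrix.mulVec_smul, hA, smul_smul, mul_comm, hxy,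
      one_smul, Matrix.one_mulVec]
  have huv : (((u : (orderOfLattice (Submodule.span ℤ (Set.range ω)))) : K)) *
      ((u⁻¹ : (orderOfLattice (Submodule.span ℤ (Set.range ω)))ˣ) :
        orderOfLattice (Submodule.span ℤ (Set.range ω))) = 1 := by
    rw [← Subring.coe_mul, Units.mul_inv, Subring.coe_one]
  let γ : GL (Fin n) ℤ := ⟨A, B, hone A B _ _ hA hB huv, hone B A _ _ hB hA ((mul_comm _ _).trans huv)⟩
  have hγ : ((g₀ * Matrix.GeneralLinearGroup.map (n := Fin n) (Int.castRingHom ℝ) γ * g₀⁻¹ :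
      GL (Fin n) ℝ) : Matrix (Fin n) (Fin n) ℝ) =
      blockMatrix hn (fun i => σ.real i ((u : orderOfLattice (Submodule.span ℤ (Set.range ω))) : K))
          (fun j => σ.cplx j ((u : orderOfLattice (Submodule.span ℤ (Set.range ω))) : K)) := by
    rw [map_intCast_eq] at hA
    have h1 := conj_eq_blockMatrix_of_mulVec_eq hn σ hK hX hω0 hω hg hA
    rw [← map_intCast_eq] at h1
    exact h1
  refine ⟨⟨⟨_, ?_, ?_⟩, ⟨_, ⟨γ, rfl⟩, rfl⟩⟩, hγ⟩
  · change Matrix.det (((g₀ * Matrix.GeneralLinearGroup.map (n := Fin n) (Int.castRingHom ℝ) γ *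
      g₀⁻¹ : GL (Fin n) ℝ) : Matrix (Fin n) (Fin n) ℝ)) = 1 ∨ Matrix.det (((g₀ *
      Matrix.GeneralLinearGroup.map (n := Fin n) (Int.castRingHom ℝ) γ *
      g₀⁻¹ : GL (Fin n) ℝ) : Matrix (Fin n) (Fin n) ℝ)) = -1
    have h1 : Matrix.det (((g₀ * Matrix.GeneralLinearGroup.map (n := Fin n) (Int.castRingHom ℝ) γ *
      g₀⁻¹ : GL (Fin n) ℝ) : Matrix (Fin n) (Fin n) ℝ)) = ((A.det : ℤ) : ℝ) := by
      rw [Units.val_mul, Units.val_mul, Matrix.det_units_conj]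
      exact ((Int.castRingHom ℝ).map_det A).symm
    have h2 : IsUnit A.det := (Matrix.isUnit_iff_isUnit_det A).1 ⟨γ, rfl⟩
    rw [h1]
    rcases Int.isUnit_iff.1 h2 with h | h <;> simp [h]
  · rw [Units.mul_inv_eq_iff_eq_mul]
    change ((g₀ * Matrix.GeneralLinearGroup.map (n := Fin n) (Int.castRingHom ℝ) γ * g₀⁻¹ :
      GL (Fin n) ℝ) : Matrix (Fin n) (Fin n) ℝ) * _ = _ *
      ((g₀ * Matrix.GeneralLinearGroup.map (n := Fin n) (Int.castRingHom ℝ) γ * g₀⁻¹ :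
      GL (Fin n) ℝ) : Matrix (Fin n) (Fin n) ℝ)
    rw [hγ, modelMatrix, blockMatrix_mul, blockMatrix_mul, mul_comm, mul_comm (fun j => σ.cplx j _)]

theorem exists_unit_of_lattice_point (hK : IntermediateField.adjoin ℚ {α} = ⊤)
    (hX : Irreducible (X₀.map (Int.cast : ℤ → ℚ)).charpoly) (hω0 : ω ≠ 0)
    (hω : (X₀.map (Int.cast : ℤ → K)).mulVec ω = α • ω)
    (hg : (g₀ : Matrix (Fin n) (Fin n) ℝ) * X₀.map (Int.cast : ℤ → ℝ) *
      ((g₀⁻¹ : GL (Fin n) ℝ) : Matrix (Fin n) (Fin n) ℝ) = modelMatrix hn σ α)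
    (l : ((glInt n).map (MulAut.conj g₀).toMonoidHom).subgroupOf (torus (modelMatrix hn σ α))) :
    ∃ u : (orderOfLattice (Submodule.span ℤ (Set.range ω)))ˣ,
      (((l : torus (modelMatrix hn σ α)) : GL (Fin n) ℝ) : Matrix (Fin n) (Fin n) ℝ) =
        blockMatrix hn (fun i => σ.real i ((u : orderOfLattice (Submodule.span ℤ (Set.range ω))) : K))
          (fun j => σ.cplx j ((u : orderOfLattice (Submodule.span ℤ (Set.range ω))) : K)) := by
  obtain ⟨⟨g, hgt⟩, hl⟩ := l
  change ∃ u : (orderOfLattice (Submodule.span ℤ (Set.range ω)))ˣ,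
    (g : Matrix (Fin n) (Fin n) ℝ) = _
  obtain ⟨_, ⟨γ, rfl⟩, hγ⟩ := hl
  replace hγ : _ = g := hγ
  subst hγ
  change ∃ u : (orderOfLattice (Submodule.span ℤ (Set.range ω)))ˣ,
    (g₀ : Matrix (Fin n) (Fin n) ℝ) * (γ : Matrix (Fin n) (Fin n) ℤ).map (Int.cast : ℤ → ℝ) *
      ((g₀⁻¹ : GL (Fin n) ℝ) : Matrix (Fin n) (Fin n) ℝ) = _
  set A : Matrix (Fin n) (Fin n) ℤ := (γ : Matrix (Fin n) (Fin n) ℤ) with hAdef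
  set B : Matrix (Fin n) (Fin n) ℤ := ((γ⁻¹ : GL (Fin n) ℤ) : Matrix (Fin n) (Fin n) ℤ) with hBdef
  -- The centralizer condition over `ℝ` descends to `ℤ` by injectivity of the cast, and then passes
  -- to `ℚ`, where `A` becomes a polynomial `p` in `X₀`; the unit sought is `p(α)`.
  have hcomm : A * X₀ = X₀ * A := by
    have h1 := hgt.2
    rw [Units.mul_inv_eq_iff_eq_mul, ← hg] at h1
    change (g₀ : Matrix (Fin n) (Fin n) ℝ) * A.map (Int.cast : ℤ → ℝ) *
      ((g₀⁻¹ : GL (Fin n) ℝ) : Matrix (Fin n) (Fin n) ℝ) * _ = _ *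
      ((g₀ : Matrix (Fin n) (Fin n) ℝ) * A.map (Int.cast : ℤ → ℝ) *
      ((g₀⁻¹ : GL (Fin n) ℝ) : Matrix (Fin n) (Fin n) ℝ)) at h1
    simp only [mul_assoc, Units.inv_mul_cancel_left] at h1
    have h2 := g₀.isUnit.mul_left_cancel h1
    rw [← mul_assoc, ← mul_assoc] at h2
    have h3 := (g₀⁻¹).isUnit.mul_right_cancel h2
    refine Matrix.map_injective (Int.cast_injective (α := ℝ)) ?_
    have h4 := fun P Q : Matrix (Fin n) (Fin n) ℤ =>
      Matrix.map_mul (L := P) (M := Q) (f := Int.castRingHom ℝ)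
    exact (h4 A X₀).trans (h3.trans (h4 X₀ A).symm)
  have hcommQ : Commute (A.map (Int.cast : ℤ → ℚ))
      ((X₀.map (Int.cast : ℤ → ℚ)).map (RingHom.id ℚ)) := by
    have h4 := fun P Q : Matrix (Fin n) (Fin n) ℤ =>
      Matrix.map_mul (L := P) (M := Q) (f := Int.castRingHom ℚ)
    exact (h4 A X₀).symm.trans ((congrArg (fun P => P.map (Int.castRingHom ℚ)) hcomm).trans
      (h4 X₀ A))
  obtain ⟨p, hp⟩ := exists_eq_aeval_of_commute (RingHom.id ℚ) hX hcommQ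
  have hid : (X₀.map (Int.cast : ℤ → ℚ)).map (RingHom.id ℚ) = X₀.map (Int.cast : ℤ → ℚ) := rfl
  rw [hid] at hp
  have hA : (A.map (Int.cast : ℤ → K)).mulVec ω = Polynomial.aeval α p • ω := by
    rw [map_intCast_eq, hp, map_aeval_matrix, ← map_intCast_eq]
    exact aeval_mulVec_of_eigenvector hω p
  set u : K := Polynomial.aeval α p with hu
  have hBA : (B.map (Int.cast : ℤ → K)).mulVec (u • ω) = ω := by
    have h1 : (B * A).map (Int.cast : ℤ → K) = B.map Int.cast * A.map Int.cast :=
      Matrix.map_mul (f := Int.castRingHom K)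
    have h2 : (1 : Matrix (Fin n) (Fin n) ℤ).map (Int.cast : ℤ → K) = 1 :=
      Matrix.map_one _ Int.cast_zero Int.cast_one
    have h3 : B * A = 1 := by rw [hBdef, hAdef, ← Units.val_mul, inv_mul_cancel, Units.val_one]
    rw [← hA, Matrix.mulVec_mulVec, ← h1, h3, h2, Matrix.one_mulVec]
  have hu0 : u ≠ 0 := by
    intro h
    rw [h, zero_smul, Matrix.mulVec_zero] at hBA
    exact hω0 hBA.symm
  have hB : (B.map (Int.cast : ℤ → K)).mulVec ω = u⁻¹ • ω := by
    conv_rhs => rw [← hBA, Matrix.mulVec_smul, smul_smul, inv_mul_cancel₀ hu0, one_smul]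
  refine ⟨⟨⟨u, mem_orderOfLattice_iff.2 ⟨A, hA⟩⟩, ⟨u⁻¹, mem_orderOfLattice_iff.2 ⟨B, hB⟩⟩,
    Subtype.ext (mul_inv_cancel₀ hu0), Subtype.ext (inv_mul_cancel₀ hu0)⟩, ?_⟩
  rw [map_intCast_eq] at hg hω hA ⊢
  exact conj_eq_blockMatrix_of_mulVec_eq hn σ hK hX hω0 hω hg hA

end Correspondence

/-! ### Counting units in the fundamental parallelotope -/

section Count

variable {K : Type*} [Field K] {r₁ r₂ : ℕ} (σ : EmbeddingNumbering K r₁ r₂)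

theorem logCoord_mul {x y : K} (hx : x ≠ 0) (hy : y ≠ 0) :
    logCoord σ (x * y) = logCoord σ x + logCoord σ y := by
  funext i
  refine Fin.addCases (fun i => ?_) (fun j => ?_) i
  · simp [logCoord, abs_mul, Real.log_mul, hx, hy]
  · simp [logCoord, Real.log_mul, hx, hy, mul_add]

/-- The first `r₁ + r₂ - 1` of the `ν_i log |σ_i(u)|`, for the units of a subring. -/
noncomputable def unitLog (O : Subring K) : Additive Oˣ →+ (Fin (r₁ + r₂ - 1) → ℝ) :=
  AddMonoidHom.mk' (fun u i => logCoord σ ((u.toMul : O) : K) (Fin.castLE (Nat.sub_le _ _) i))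
    fun u v => by
      have h : ∀ u : Oˣ, ((u : O) : K) ≠ 0 := fun u h => u.ne_zero (Subtype.ext h)
      funext i
      rw [toMul_add, Units.val_mul, Subring.coe_mul, logCoord_mul σ (h _) (h _)]
      rfl

theorem unitLog_apply {O : Subring K} (u : Oˣ) (i : Fin (r₁ + r₂ - 1)) :
    unitLog σ O (Additive.ofMul u) i =
      logCoord σ ((u : O) : K) (Fin.castLE (Nat.sub_le _ _) i) :=
  rfl

/-- An element of finite order maps to a torsion element of a real vector space. -/
theorem unitLog_torsion {O : Subring K} {ζ : Oˣ} (hζ : ζ ∈ CommGroup.torsion Oˣ) :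
    unitLog σ O (Additive.ofMul ζ) = 0 := by
  obtain ⟨k, hk, h⟩ := isOfFinOrder_iff_pow_eq_one.1 hζ
  have h1 : k • unitLog σ O (Additive.ofMul ζ) = 0 := by
    rw [← map_nsmul, ← ofMul_pow, h, ofMul_one, map_zero]
  exact (smul_eq_zero.1 h1).resolve_left hk.ne'

/-- The parametrization of the units given by a system of fundamental units. -/
noncomputable def fundamentalEquiv {O : Subring K} {m : ℕ} {ε : Fin m → Oˣ}
    (hε : IsFundamentalSystem O ε) : CommGroup.torsion Oˣ × (Fin m → ℤ) ≃ Oˣ :=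
  Equiv.ofBijective (fun p => (p.1 : Oˣ) * ∏ j, ε j ^ p.2 j)
    ((Function.bijective_iff_existsUnique _).2 fun u => by simpa only [eq_comm] using hε u)

theorem unitLog_fundamentalEquiv {O : Subring K} {ε : Fin (r₁ + r₂ - 1) → Oˣ}
    (hε : IsFundamentalSystem O ε) (p : CommGroup.torsion Oˣ × (Fin (r₁ + r₂ - 1) → ℤ)) :
    unitLog σ O (Additive.ofMul (fundamentalEquiv hε p)) =
      ∑ j, (p.2 j : ℝ) • unitLog σ O (Additive.ofMul (ε j)) := by
  change unitLog σ O (Additive.ofMul ((p.1 : Oˣ) * ∏ j, ε j ^ p.2 j)) = _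
  rw [ofMul_mul, map_add, unitLog_torsion σ p.1.2, zero_add, ofMul_prod, map_sum]
  refine Finset.sum_congr rfl fun j _ => ?_
  rw [ofMul_zpow, map_zsmul, Int.cast_smul_eq_zsmul]

theorem regulatorOf_eq_abs_det {O : Subring K} (ε : Fin (r₁ + r₂ - 1) → Oˣ) :
    regulatorOf σ ε =
      |(Matrix.of fun j => unitLog σ O (Additive.ofMul (ε j))).det| := by
  rw [regulatorOf, ← Matrix.det_transpose]
  rfl

theorem exists_basis_unitLog {O : Subring K} {ε : Fin (r₁ + r₂ - 1) → Oˣ}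
    (h : regulatorOf σ ε ≠ 0) : ∃ b : Module.Basis (Fin (r₁ + r₂ - 1)) ℝ (Fin (r₁ + r₂ - 1) → ℝ),
      ∀ j, b j = unitLog σ O (Additive.ofMul (ε j)) := by
  classical
  rw [regulatorOf_eq_abs_det, abs_ne_zero] at h
  have hli := Matrix.linearIndependent_rows_of_det_ne_zero h
  exact ⟨basisOfPiSpaceOfLinearIndependent hli, fun j => by
    rw [coe_basisOfPiSpaceOfLinearIndependent]
    rfl⟩

/-- For each root of unity exactly one exponent vector brings the point into the half-open
parallelotope, namely minus the floors of the coordinates of `x`; the sum therefore counts roots of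
unity. -/
theorem tsum_indicator_unitLog {O : Subring K} {ε : Fin (r₁ + r₂ - 1) → Oˣ}
    (hε : IsFundamentalSystem O ε) (hfin : Finite (CommGroup.torsion Oˣ))
    {b : Module.Basis (Fin (r₁ + r₂ - 1)) ℝ (Fin (r₁ + r₂ - 1) → ℝ)}
    (hb : ∀ j, b j = unitLog σ O (Additive.ofMul (ε j))) (x : Fin (r₁ + r₂ - 1) → ℝ) :
    ∑' u : Oˣ, (ZSpan.fundamentalDomain b).indicator (1 : (Fin (r₁ + r₂ - 1) → ℝ) → ENNReal)
      (x + unitLog σ O (Additive.ofMul u)) = numRootsOfUnity O := by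
  have := Fintype.ofFinite (CommGroup.torsion Oˣ)
  rw [← (fundamentalEquiv hε).tsum_eq, ENNReal.tsum_prod']
  have hmem : ∀ p : CommGroup.torsion Oˣ × (Fin (r₁ + r₂ - 1) → ℤ),
      x + unitLog σ O (Additive.ofMul (fundamentalEquiv hε p)) ∈ ZSpan.fundamentalDomain b ↔
        p.2 = fun j => -⌊b.repr x j⌋ := by
    intro p
    rw [unitLog_fundamentalEquiv, ZSpan.mem_fundamentalDomain, funext_iff]
    refine forall_congr' fun j => ?_
    simp_rw [← hb]
    rw [map_add, Finsupp.add_apply, b.repr_sum_self, eq_neg_iff_add_eq_zero, add_comm (p.2 j),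
      ← Int.floor_add_intCast, Int.floor_eq_zero_iff]
  have hinner : ∀ ζ : CommGroup.torsion Oˣ, ∑' k : Fin (r₁ + r₂ - 1) → ℤ,
      (ZSpan.fundamentalDomain b).indicator (1 : (Fin (r₁ + r₂ - 1) → ℝ) → ENNReal)
        (x + unitLog σ O (Additive.ofMul (fundamentalEquiv hε (ζ, k)))) = 1 := by
    intro ζ
    rw [tsum_eq_single fun j => -⌊b.repr x j⌋]
    · rw [Set.indicator_of_mem ((hmem _).2 rfl)]
      rfl
    · intro k hk
      exact Set.indicator_of_notMem (fun h => hk ((hmem _).1 h)) _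
  simp_rw [hinner]
  rw [tsum_fintype, Finset.sum_const, Finset.card_univ, numRootsOfUnity,
    Nat.card_eq_fintype_card, nsmul_one]

end Count

/-! ### Transport along conjugation by `g₀` -/

section Transport

variable {n : ℕ} {X Y : Matrix (Fin n) (Fin n) ℝ} (g₀ : GL (Fin n) ℝ)
  (hg : (g₀ : Matrix (Fin n) (Fin n) ℝ) * X *
      ((g₀⁻¹ : GL (Fin n) ℝ) : Matrix (Fin n) (Fin n) ℝ) = Y)

theorem measurable_conjTorus : Measurable (conjTorus g₀ hg) :=
  (((continuous_const.mul continuous_subtype_val).mul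
    continuous_const).subtype_mk _ : Continuous (conjTorus g₀ hg)).measurable

theorem measurable_conjTorus_symm : Measurable (conjTorus g₀ hg).symm :=
  (((continuous_const.mul continuous_subtype_val).mul
    continuous_const).subtype_mk _ : Continuous (conjTorus g₀ hg).symm).measurable

theorem conjTorus_mem_iff (Γ : Subgroup (GL (Fin n) ℝ)) (h : torus X) :
    h ∈ Γ.subgroupOf (torus X) ↔
      conjTorus g₀ hg h ∈ (Γ.map (MulAut.conj g₀).toMonoidHom).subgroupOf (torus Y) := by
  rw [Subgroup.mem_subgroupOf, Subgroup.mem_subgroupOf]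
  exact (Subgroup.mem_map_iff_mem (MulAut.conj g₀).injective).symm

theorem exists_quotientMeasure {H : Type*} [Group H] [MeasurableSpace H] (Λ : Subgroup H)
    [Countable Λ] (μ : Measure H)
    (hm : ∀ l : Λ, Measurable fun h : H => h * l)
    (hinv : ∀ l : Λ, μ.map (fun h : H => h * l) = μ)
    {F : Set H} (hF : MeasurableSet F) {w : ENNReal} (hw0 : w ≠ 0) (hwt : w ≠ ⊤)
    (hcount : ∀ h : H, ∑' l : Λ, F.indicator 1 (h * l) = w) :
    ∃ ν : Measure (H ⧸ Λ), (∀ ν', IsQuotientMeasure Λ μ ν' ↔ ν' = ν) ∧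
      ν Set.univ = w⁻¹ * μ F := by
  refine ⟨_, isQuotientMeasure_iff Λ μ hm hinv hF hw0 hwt hcount, ?_⟩
  rw [Measure.smul_apply, Measure.map_apply QuotientGroup.measurable_coe MeasurableSet.univ,
    Set.preimage_univ, Measure.restrict_apply_univ, smul_eq_mul]

theorem measurable_mul_right_torus (l : torus X) : Measurable fun h : torus X => h * l :=
  (continuous_mul_const l).measurable

/-- Conjugation matches the two lattices, so the preimage of `F` has the same measure and the same
intersection count with cosets. Both quotients thus get the total mass `w⁻¹ * μ F`. -/
theorem exists_quotientMeasure_conjTorus (Γ : Subgroup (GL (Fin n) ℝ)) (μ : Measure (torus Y))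
    (hc : Countable ((Γ.map (MulAut.conj g₀).toMonoidHom).subgroupOf (torus Y)))
    (hinv : ∀ l : (Γ.map (MulAut.conj g₀).toMonoidHom).subgroupOf (torus Y),
      μ.map (fun h => h * (l : torus Y)) = μ)
    {F : Set (torus Y)} (hF : MeasurableSet F) {w : ENNReal} (hw0 : w ≠ 0) (hwt : w ≠ ⊤)
    (hcount : ∀ h, ∑' l : (Γ.map (MulAut.conj g₀).toMonoidHom).subgroupOf (torus Y),
      F.indicator 1 (h * (l : torus Y)) = w) :
    ∃ ν : Measure (torus X ⧸ Γ.subgroupOf (torus X)),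
      (∀ ν', IsQuotientMeasure (Γ.subgroupOf (torus X)) (μ.map (conjTorus g₀ hg).symm) ν' ↔
        ν' = ν) ∧ ν Set.univ = w⁻¹ * μ F := by
  let e := conjTorus g₀ hg
  let E : Γ.subgroupOf (torus X) ≃
      (Γ.map (MulAut.conj g₀).toMonoidHom).subgroupOf (torus Y) :=
    e.toEquiv.subtypeEquiv (conjTorus_mem_iff g₀ hg Γ)
  have hc' : Countable (Γ.subgroupOf (torus X)) := E.countable_iff.2 hc
  have hes := measurable_conjTorus_symm g₀ hg
  have hF' : MeasurableSet (e ⁻¹' F) := measurable_conjTorus g₀ hg hF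
  have key : μ.map (conjTorus g₀ hg).symm (e ⁻¹' F) = μ F := by
    rw [Measure.map_apply hes hF', ← Set.preimage_comp]
    congr 1
    ext x
    change e (e.symm x) ∈ F ↔ _
    rw [e.apply_symm_apply]
  rw [← key]
  refine exists_quotientMeasure _ _ (fun l => measurable_mul_right_torus _) (fun l => ?_) hF' hw0
    hwt (fun h => ?_)
  · have h1 := hinv (E l)
    rw [Measure.map_map (measurable_mul_right_torus _) hes]
    conv_rhs => rw [← h1]
    rw [Measure.map_map hes (measurable_mul_right_torus _)]
    congr 1
    funext h
    change e.symm h * (l : torus X) = e.symm (h * e l)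
    rw [map_mul, e.symm_apply_apply]
  · rw [← hcount (e h), ← E.tsum_eq]
    refine tsum_congr fun l => ?_
    change F.indicator 1 (e (h * l)) = F.indicator 1 (e h * e l)
    rw [map_mul]

end Transport

/-! ### The fundamental set and its volume -/

section Main

set_option linter.unusedSectionVars false

variable {K : Type*} [Field K] [NumberField K] {n r₁ r₂ : ℕ} (hn : r₁ + r₂ * 2 = n)
  (σ : EmbeddingNumbering K r₁ r₂)

theorem finrank_eq_of_numbering (hn : r₁ + r₂ * 2 = n) (σ : EmbeddingNumbering K r₁ r₂) :
    Module.finrank ℚ K = n := by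
  rw [← NumberField.Embeddings.card K ℂ, ← Fintype.card_congr (Equiv.ofBijective _ σ.bijective)]
  simp only [Fintype.card_sum, Fintype.card_fin]
  omega

theorem blockLog_embeddings (u : K) :
    blockLog hn (blockMatrix hn (fun i => σ.real i u) (fun j => σ.cplx j u)) = logCoord σ u := by
  funext i
  refine Fin.addCases (fun i => ?_) (fun j => ?_) i
  · rw [blockLog_blockMatrix_castAdd, logCoord, Fin.addCases_left]
  · rw [blockLog_blockMatrix_natAdd, logCoord, Fin.addCases_right]

theorem eq_of_blockMatrix_embeddings_eq {u v : K}
    (h : blockMatrix hn (fun i => σ.real i u) (fun j => σ.cplx j u) =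
      blockMatrix hn (fun i => σ.real i v) (fun j => σ.cplx j v)) : u = v := by
  obtain ⟨h1, h2⟩ := blockMatrix_injective hn h
  have hpos := pos_of_numbering σ
  -- A single embedding determines a field element; without real embeddings there is a complex one.
  rcases Nat.eq_zero_or_pos r₁ with h0 | h0
  · exact (σ.cplx ⟨0, by omega⟩).injective (congrFun h2 _)
  · exact (σ.real ⟨0, h0⟩).injective (congrFun h1 _)

/-- A subgroup of the model torus whose elements are the images of the units of an order under the
embeddings of `K` meets the translates of `freeLog⁻¹ D` in as many points as there are roots of
unity, where `D` is the fundamental parallelotope of a system of fundamental units. -/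
theorem exists_fundamental_set {b : Fin r₁ → ℝ} {w : Fin r₂ → ℂ} {O : Subring K}
    (hO : ∀ x ∈ O, IsIntegral ℤ x) (hfin : (unitsInclusion O hO).range.FiniteIndex)
    (hblock : ∀ h : torus (blockMatrix hn b w),
      ∃ a z, ((h : GL (Fin n) ℝ) : Matrix (Fin n) (Fin n) ℝ) = blockMatrix hn a z)
    (Λ : Subgroup (torus (blockMatrix hn b w)))
    (hΛ₁ : ∀ u : Oˣ, ∃ l : Λ,
      (((l : torus (blockMatrix hn b w)) : GL (Fin n) ℝ) : Matrix (Fin n) (Fin n) ℝ) =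
        blockMatrix hn (fun i => σ.real i ((u : O) : K)) (fun j => σ.cplx j ((u : O) : K)))
    (hΛ₂ : ∀ l : Λ, ∃ u : Oˣ,
      (((l : torus (blockMatrix hn b w)) : GL (Fin n) ℝ) : Matrix (Fin n) (Fin n) ℝ) =
        blockMatrix hn (fun i => σ.real i ((u : O) : K)) (fun j => σ.cplx j ((u : O) : K))) :
    Countable Λ ∧ ∃ F : Set (torus (blockMatrix hn b w)), MeasurableSet F ∧
      haarModel hn b w F = 2 ^ r₁ * ENNReal.ofReal (orderRegulator hO) ∧
      ∀ h, ∑' l : Λ, F.indicator 1 (h * (l : torus (blockMatrix hn b w))) =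
        (numRootsOfUnity O : ENNReal) := by
  obtain ⟨⟨ε, hε⟩, hreg⟩ := isRegulator_orderRegulator σ hO hfin
  have hR := hreg ε hε
  have hRne : regulatorOf σ ε ≠ 0 := by
    rw [hR]
    exact orderRegulator_ne_zero hO hfin
  obtain ⟨B, hB⟩ := exists_basis_unitLog σ hRne
  have htor : Finite (CommGroup.torsion Oˣ) := finite_torsion_units hO
  choose φ hφ using hΛ₁
  -- The block matrix determines both the unit and the lattice element, so sums over `Λ` become sums
  -- over units.
  have hφbij : Function.Bijective φ := by
    constructor
    · intro u v h
      refine Units.ext (Subtype.ext (eq_of_blockMatrix_embeddings_eq hn σ ?_))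
      rw [← hφ u, ← hφ v, h]
    · intro l
      obtain ⟨u, hu⟩ := hΛ₂ l
      exact ⟨u, Subtype.ext (torus_ext ((hφ u).trans hu.symm))⟩
  let E := Equiv.ofBijective φ hφbij
  have hmeas : MeasurableSet {h : torus (blockMatrix hn b w) |
      freeLog hn (h : GL (Fin n) ℝ) ∈ ZSpan.fundamentalDomain B} :=
    measurable_freeLog hn (ZSpan.fundamentalDomain_measurableSet B)
  refine ⟨((fundamentalEquiv hε).trans E).countable_iff.1 inferInstance, _, hmeas, ?_, fun h => ?_⟩
  · rw [haarModel_preimage_freeLog hn b w (ZSpan.fundamentalDomain_measurableSet B),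
      ZSpan.volume_fundamentalDomain, ← hR, regulatorOf_eq_abs_det]
    congr 5
    ext i j
    rw [hB]
  · rw [← tsum_indicator_unitLog σ hε htor hB (freeLog hn (h : GL (Fin n) ℝ)), ← E.tsum_eq]
    refine tsum_congr fun u => ?_
    -- The logarithms are additive on block matrices, so translating `h` by a unit translates
    -- `freeLog h` by the logarithms of that unit.
    have hlog : freeLog hn (((h * (φ u : torus (blockMatrix hn b w)) :
        torus (blockMatrix hn b w)) : GL (Fin n) ℝ) : Matrix (Fin n) (Fin n) ℝ) =
        freeLog hn (h : GL (Fin n) ℝ) + unitLog σ O (Additive.ofMul u) := by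
      obtain ⟨a, z, e⟩ := hblock h
      funext i
      rw [Pi.add_apply, freeLog, freeLog, Subgroup.coe_mul, Units.val_mul, e, hφ,
        blockLog_mul hn (norm_prod_eq_one_of_mem hn b w e)
          (norm_prod_eq_one_of_mem hn b w (hφ u)), Pi.add_apply, blockLog_embeddings,
        unitLog_apply]
    rw [← hlog]
    rfl

end Main

end CentralizerTorus

/-! ### The volume formula -/

open CentralizerTorus in
theorem mainTheorem6 {n : ℕ} (hn2 : 2 ≤ n)
    (P : Polynomial ℤ) (hPmonic : P.Monic) (hPdeg : P.natDegree = n)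
    (hPirr : Irreducible (P.map (Int.castRingHom ℚ)))
    {K : Type*} [Field K] [NumberField K] (α : K) (hα : Polynomial.aeval α P = 0)
    (hK : IntermediateField.adjoin ℚ {α} = ⊤)
    {r₁ r₂ : ℕ} (hn : r₁ + r₂ * 2 = n) (σ : CentralizerTorus.EmbeddingNumbering K r₁ r₂)
    (X₀ : Matrix (Fin n) (Fin n) ℤ) (hX₀ : X₀.charpoly = P)
    (ω : Fin n → K) (hω_mem : ∀ i, ω i ∈ Algebra.adjoin ℤ {α}) (hω_ne : ω ≠ 0)
    (hω : (X₀.map (Int.cast : ℤ → K)).mulVec ω = α • ω)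
    (g₀ : GL (Fin n) ℝ) (_hg₀ : g₀ ∈ CentralizerTorus.detPmOne n)
    (hg : (g₀ : Matrix (Fin n) (Fin n) ℝ) * X₀.map (Int.cast : ℤ → ℝ) *
      ((g₀⁻¹ : GL (Fin n) ℝ) : Matrix (Fin n) (Fin n) ℝ) =
        CentralizerTorus.modelMatrix hn σ α) :
    let H := CentralizerTorus.torus (X₀.map (Int.cast : ℤ → ℝ))
    let H₁ := CentralizerTorus.torus (CentralizerTorus.modelMatrix hn σ α)
    let Γ := CentralizerTorus.glInt n
    let Γ₁ := Γ.map (MulAut.conj g₀).toMonoidHom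
    let 𝔒 := CentralizerTorus.orderOfLattice (Submodule.span ℤ (Set.range ω))
    ∃ (R : ℝ) (ν : Measure (H ⧸ Γ.subgroupOf H)) (ν₁ : Measure (H₁ ⧸ Γ₁.subgroupOf H₁)),
      CentralizerTorus.IsRegulator σ 𝔒 R ∧
      (∀ ν' : Measure (H ⧸ Γ.subgroupOf H),
        CentralizerTorus.IsQuotientMeasure (Γ.subgroupOf H)
          (CentralizerTorus.haarH hn σ α g₀ hg) ν' ↔ ν' = ν) ∧
      (∀ ν₁' : Measure (H₁ ⧸ Γ₁.subgroupOf H₁),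
        CentralizerTorus.IsQuotientMeasure (Γ₁.subgroupOf H₁)
          (CentralizerTorus.haarH₁ hn σ α) ν₁' ↔ ν₁' = ν₁) ∧
      ν Set.univ = ν₁ Set.univ ∧
      ν₁ Set.univ =
        ENNReal.ofReal (2 ^ r₁ * R / (CentralizerTorus.numRootsOfUnity 𝔒 : ℝ)) := by
  intro H H₁ Γ Γ₁ 𝔒
  have hX : Irreducible (X₀.map (Int.cast : ℤ → ℚ)).charpoly := by
    have h := Matrix.charpoly_map X₀ (Int.castRingHom ℚ)
    rw [hX₀] at h
    have h' : (X₀.map (Int.cast : ℤ → ℚ)).charpoly = P.map (Int.castRingHom ℚ) := h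
    rwa [h']
  have hgQ := hg
  rw [map_intCast_eq] at hgQ
  have hωQ := hω
  rw [map_intCast_eq] at hωQ
  have hO := isIntegral_of_mem_orderOfLattice hω_ne
  have hfin : (unitsInclusion 𝔒 hO).range.FiniteIndex :=
    finiteIndex_units_orderOfLattice (linearIndependent_eigenvector hX hω_ne hωQ)
      (finrank_eq_of_numbering hn σ) hω_ne
  have hΛ₂ := exists_unit_of_lattice_point hn σ hK hX hω_ne hω hg
  have hblock := exists_eq_blockMatrix_of_mem_torus hn hX (b := fun i => σ.real i α)
    (w := fun j => σ.cplx j α) hgQ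
  obtain ⟨hc, F, hF, hvol, hcount⟩ := exists_fundamental_set hn σ hO hfin hblock
    (Γ₁.subgroupOf H₁) (exists_lattice_point_of_unit hn σ hK hX hω_ne hω hg) hΛ₂
  have hc' : Countable (Γ₁.subgroupOf H₁) := hc
  -- Lattice elements are block matrices, hence polar points, and the measure is invariant under
  -- those.
  have hinv : ∀ l : Γ₁.subgroupOf H₁,
      (haarH₁ hn σ α).map (fun h => h * (l : H₁)) = haarH₁ hn σ α := by
    intro l
    obtain ⟨u, hu⟩ := hΛ₂ l
    obtain ⟨ε, θ, x, h⟩ := exists_eq_polarPoint hn (fun i => σ.real i α) (fun j => σ.cplx j α)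
      (h := (l : H₁)) hu
    rw [h]
    exact map_haarModel_mul_polarPoint hn _ _ ε θ x
  have htor : Finite (CommGroup.torsion 𝔒ˣ) := finite_torsion_units hO
  have hw : numRootsOfUnity 𝔒 ≠ 0 := Nat.card_pos.ne'
  have hw0 : (numRootsOfUnity 𝔒 : ENNReal) ≠ 0 := Nat.cast_ne_zero.2 hw
  have hwt : (numRootsOfUnity 𝔒 : ENNReal) ≠ ⊤ := ENNReal.natCast_ne_top _
  obtain ⟨ν, hν, hνuniv⟩ := exists_quotientMeasure_conjTorus g₀ hg Γ (haarH₁ hn σ α) hc hinv hF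
    hw0 hwt hcount
  obtain ⟨ν₁, hν₁, hν₁univ⟩ := exists_quotientMeasure (Γ₁.subgroupOf H₁) (haarH₁ hn σ α)
    (fun l => measurable_mul_right_torus _) hinv hF hw0 hwt hcount
  refine ⟨orderRegulator hO, ν, ν₁, isRegulator_orderRegulator σ hO hfin, hν, hν₁,
    hνuniv.trans hν₁univ.symm, ?_⟩
  have hvol' : haarH₁ hn σ α F = 2 ^ r₁ * ENNReal.ofReal (orderRegulator hO) := hvol
  rw [hν₁univ, hvol', ENNReal.ofReal_div_of_pos (by exact_mod_cast Nat.pos_of_ne_zero hw),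
    ENNReal.ofReal_mul (by positivity), ENNReal.ofReal_pow zero_le_two, ENNReal.ofReal_ofNat,
    ENNReal.ofReal_natCast, mul_comm, ENNReal.div_eq_inv_mul, mul_comm]
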